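/- Let $N$ be a von Neumann algebra acting on a Hilbert space $H$, let $J\subseteq N$ be a norm closed two-sided ideal, and let $\pi:N\to N/J$ be the quotient map. For projections $p,q$ on $H$ let $p\cap q$ be the projection onto $\mathrm{Im}(p)\cap\mathrm{Im}(q)$, let $N(S)$ be the projection onto $\ker S$, and let $\chi$ be the indicator function of $[0,\infty)$. An operator $S\in qNp$ ($p,q\in N$ projections) is $(q\text{-}p)$-Fredholm if there is $T\in pNq$ with $\pi(TS)=\pi(p)$ and $\pi(ST)=\pi(q)$; its index is then $\mathrm{Ind}_{(q\text{-}p)}(S)=[N(S)\cap p]-[N(S^*)\cap q]\in K_0(J)$. The spectral flow of a norm continuous path $\{B_t\}_{t\in[0,1]}$ of self-adjoint elements of $N$ with every $\pi(B_t)$ invertible in $N/J$ is $$\mathrm{sf}\{B_t\}=\sum_{i=1}^n\big([(1-q_i)\cap q_{i-1}]-[(1-q_{i-1})\cap q_i]\big)\in K_0(J),\qquad q_i=\chi(B_{t_i}),$$ for any partition $0=t_0<t_1<\dots<t_n=1$ with $\|\pi(\chi(B_t))-\pi(\chi(B_s))\|<1/2$ for all $s,t\in[t_{i-1},t_i]$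 and all $i$. Let $(\mathcal A,H,\mathcal D)$ be a unital von Neumann spectral triple relative to $(N,J)$: $\mathcal A$ is a $*$-algebra represented in $N$ with the unit of $N$ in its image, $\mathcal D$ is a self-adjoint operator affiliated to $N$, for every $a\in\mathcal A$ the commutator $[\mathcal D,a]$ is defined on $\mathrm{Dom}(\mathcal D)$ and extends to a bounded operator, and $a(\lambda-\mathcal D)^{-1}\in J$ for all $a\in\mathcal A$ and $\lambda\in\mathbb C\setminus\mathbb R$. Let $\{A_t\}_{t\in[0,1]}$ be a norm continuous path of self-adjoint elements of $N$. Put $\mathcal D_t=\mathcal D+A_t$, $F_{\mathcal D_t}=\mathcal D_t(1+\mathcal D_t^2)^{-1/2}$, $p_0=\chi(F_{\mathcal D_0})$ and $p_1=\chi(F_{\mathcal D_1})$ (that is, with $\mathcal D_0=\mathcal D+A_0$ and $\mathcal D_1=\mathcal D+A_1$). Then the operators $\mathcal D_t$ are self-adjoint and affiliated to $N$, and $t\mapsto F_{\mathcal D_t}$ is a norm continuous path of self-adjoint elements of $N$ with invertible image in $N/J$, whose spectral flow $\mathrm{sf}\{\mathcal D_t\}:=\mathrm{sf}\{F_{\mathcal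 D_t}\}$ is well defined (admissible partitions exist, the projections in the sum lie in $J$, and the sum does not depend on the partition). The projections $(1-p_1)\cap p_0$ and $(1-p_0)\cap p_1$ lie in $J$, the operator $p_1p_0$ is $(p_1\text{-}p_0)$-Fredholm, and $$\mathrm{sf}\{\mathcal D_t\}=\mathrm{sf}\{F_{\mathcal D_t}\}=[(1-p_1)\cap p_0]-[(1-p_0)\cap p_1]=\mathrm{Ind}_{(p_1\text{-}p_0)}(p_1p_0)\in K_0(J).$$ In particular $\mathrm{sf}\{\mathcal D_t\}$ depends only on the end points $\mathcal D+A_0$ and $\mathcal D+A_1$: any other norm continuous path $\{A'_t\}$ of self-adjoint elements of $N$ with $\mathcal D+A'_0=\mathcal D+A_0$ and $\mathcal D+A'_1=\mathcal D+A_1$ gives the same class. -/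

import Mathlib

open scoped unitInterval

noncomputable section

namespace VNSpectralFlow

/-! ### The `K₀`-group of a ring and of a (possibly non-unital) complex algebra -/

section KTheory

universe u v

/-- Idempotent square matrices of arbitrary finite size over `R`. -/
structure IdemMatrix (R : Type u) [Ring R] : Type u where
  size : ℕ
  mat : Matrix (Fin size) (Fin size) R
  idem : IsIdempotentElem mat

/-- The block sum `e ⊕ f = diag(e, f)` of two square matrices. -/
def blockSum {R : Type u} [Ring R] {n m : ℕ} (e : Matrix (Fin n) (Fin n) R)
    (f : Matrix (Fin m) (Fin m) R) : Matrix (Fin (n + m)) (Fin (n + m)) R :=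
  (Matrix.fromBlocks e 0 0 f).submatrix finSumFinEquiv.symm finSumFinEquiv.symm

theorem blockSum_idem {R : Type u} [Ring R] {n m : ℕ} {e : Matrix (Fin n) (Fin n) R}
    {f : Matrix (Fin m) (Fin m) R} (he : IsIdempotentElem e) (hf : IsIdempotentElem f) :
    IsIdempotentElem (blockSum e f) := by
  unfold IsIdempotentElem blockSum at *
  rw [Matrix.submatrix_mul_equiv, Matrix.fromBlocks_multiply]
  simp [he, hf]

theorem blockSum_zero {R : Type u} [Ring R] (n m : ℕ) :
    blockSum (0 : Matrix (Fin n) (Fin n) R) (0 : Matrix (Fin m) (Fin m) R) = 0 := by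
  simp [blockSum]

/-- Algebraic (Murray-von Neumann) equivalence of idempotents, possibly of different sizes:
`e = a b` and `f = b a` for some rectangular matrices `a`, `b`. -/
def IdemEquiv {R : Type u} [Ring R] (e f : IdemMatrix R) : Prop :=
  ∃ (a : Matrix (Fin e.size) (Fin f.size) R) (b : Matrix (Fin f.size) (Fin e.size) R),
    a * b = e.mat ∧ b * a = f.mat

/-- The block sum of idempotent matrices. -/
def IdemMatrix.sum {R : Type u} [Ring R] (e f : IdemMatrix R) : IdemMatrix R where
  size := e.size + f.size
  mat := blockSum e.mat f.mat
  idem := blockSum_idem e.idem f.idem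

/-- The relations `[e] = [f]` for equivalent `e`, `f`, and `[e ⊕ f] = [e] + [f]`. -/
def K0Relations (R : Type u) [Ring R] : AddSubgroup (FreeAbelianGroup (IdemMatrix R)) :=
  AddSubgroup.closure
    ({x | ∃ e f : IdemMatrix R, IdemEquiv e f ∧
        x = FreeAbelianGroup.of e - FreeAbelianGroup.of f} ∪
     {x | ∃ e f : IdemMatrix R, x = FreeAbelianGroup.of (e.sum f) -
        (FreeAbelianGroup.of e + FreeAbelianGroup.of f)})

/-- `K₀` of a unital ring: the Grothendieck group of the monoid of equivalence classes of
idempotent matrices under block sum, presented by generators and relations. -/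
abbrev K0Unital (R : Type u) [Ring R] : Type u :=
  FreeAbelianGroup (IdemMatrix R) ⧸ K0Relations R

/-- The class `[e]` of an idempotent matrix. -/
def K0Unital.mk {R : Type u} [Ring R] (e : IdemMatrix R) : K0Unital R :=
  QuotientAddGroup.mk' (K0Relations R) (FreeAbelianGroup.of e)

theorem K0Unital.mk_eq_of_equiv {R : Type u} [Ring R] {e f : IdemMatrix R} (h : IdemEquiv e f) :
    K0Unital.mk e = K0Unital.mk f := by
  have : FreeAbelianGroup.of e - FreeAbelianGroup.of f ∈ K0Relations R :=
    AddSubgroup.subset_closure (Or.inl ⟨e, f, h, rfl⟩)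
  have h2 := (QuotientAddGroup.eq_zero_iff _).2 this
  exact sub_eq_zero.1 h2

theorem K0Unital.mk_sum {R : Type u} [Ring R] (e f : IdemMatrix R) :
    K0Unital.mk (e.sum f) = K0Unital.mk e + K0Unital.mk f := by
  have : FreeAbelianGroup.of (e.sum f) -
      (FreeAbelianGroup.of e + FreeAbelianGroup.of f) ∈ K0Relations R :=
    AddSubgroup.subset_closure (Or.inr ⟨e, f, rfl⟩)
  have h2 := (QuotientAddGroup.eq_zero_iff _).2 this
  exact sub_eq_zero.1 h2

/-- Entrywise application of a ring homomorphism to an idempotent matrix. -/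
def IdemMatrix.map {R : Type u} {S : Type v} [Ring R] [Ring S] (φ : R →+* S) (e : IdemMatrix R) :
    IdemMatrix S where
  size := e.size
  mat := e.mat.map φ
  idem := by
    have h := e.idem
    unfold IsIdempotentElem at *
    rw [← Matrix.map_mul, h]

theorem IdemMatrix.map_sum {R : Type u} {S : Type v} [Ring R] [Ring S] (φ : R →+* S)
    (e f : IdemMatrix R) : (e.sum f).map φ = (e.map φ).sum (f.map φ) := by
  simp only [IdemMatrix.map, IdemMatrix.sum, blockSum, ← Matrix.submatrix_map,
    Matrix.fromBlocks_map, Matrix.map_zero _ (map_zero φ)]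
  rfl

theorem IdemEquiv.map {R : Type u} {S : Type v} [Ring R] [Ring S] (φ : R →+* S)
    {e f : IdemMatrix R} (h : IdemEquiv e f) : IdemEquiv (e.map φ) (f.map φ) := by
  obtain ⟨a, b, h1, h2⟩ := h
  refine ⟨a.map φ, b.map φ, ?_, ?_⟩
  · simp only [IdemMatrix.map, ← h1, Matrix.map_mul]
    rfl
  · simp only [IdemMatrix.map, ← h2, Matrix.map_mul]
    rfl

/-- The homomorphism of `K₀`-groups induced by a homomorphism of unital rings. -/
def K0Unital.map {R : Type u} {S : Type v} [Ring R] [Ring S] (φ : R →+* S) :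
    K0Unital R →+ K0Unital S :=
  QuotientAddGroup.lift (K0Relations R)
    (FreeAbelianGroup.lift fun e => K0Unital.mk (e.map φ)) (by
      rw [K0Relations, AddSubgroup.closure_le]
      rintro x (⟨e, f, h, rfl⟩ | ⟨e, f, rfl⟩)
      · simp [K0Unital.mk_eq_of_equiv (h.map φ)]
      · simp [IdemMatrix.map_sum, K0Unital.mk_sum])

theorem K0Unital.map_mk {R : Type u} {S : Type v} [Ring R] [Ring S] (φ : R →+* S)
    (e : IdemMatrix R) : K0Unital.map φ (K0Unital.mk e) = K0Unital.mk (e.map φ) :=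
  FreeAbelianGroup.lift_apply_of _ _

/-- The augmentation `J⁺ = ℂ ⊕ J → ℂ` of the unitization. -/
def augmentation (J : Type u) [NonUnitalRing J] [Module ℂ J] [IsScalarTower ℂ J J]
    [SMulCommClass ℂ J J] : Unitization ℂ J →+* ℂ :=
  (Unitization.fstHom ℂ J).toRingHom

/-- `K₀(J) = ker (K₀(J⁺) → K₀(ℂ))` for a possibly non-unital complex algebra `J`. -/
def K0 (J : Type u) [NonUnitalRing J] [Module ℂ J] [IsScalarTower ℂ J J]
    [SMulCommClass ℂ J J] : AddSubgroup (K0Unital (Unitization ℂ J)) :=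
  (K0Unital.map (augmentation J)).ker

/-- An idempotent `p` of `R`, as a `1 × 1` matrix. -/
def IdemMatrix.single {R : Type u} [Ring R] (p : R) (hp : IsIdempotentElem p) : IdemMatrix R where
  size := 1
  mat := Matrix.of fun _ _ => p
  idem := by
    unfold IsIdempotentElem at *
    ext i j
    simp [Matrix.mul_apply, hp]

theorem K0Unital.mk_single_zero {R : Type u} [Ring R] (h : IsIdempotentElem (0 : R)) :
    K0Unital.mk (IdemMatrix.single 0 h) = 0 := by
  have h1 : IdemEquiv ((IdemMatrix.single 0 h).sum (IdemMatrix.single 0 h))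
      (IdemMatrix.single 0 h) := by
    refine ⟨0, 0, ?_, ?_⟩
    · exact (Matrix.zero_mul _).trans (blockSum_zero 1 1).symm
    · refine (Matrix.zero_mul _).trans ?_
      rfl
  have h2 := K0Unital.mk_eq_of_equiv h1
  rw [K0Unital.mk_sum] at h2
  exact add_eq_left.1 h2

/-- The class `[p] ∈ K₀(J)` of an idempotent `p ∈ J`. -/
def K0.mk {J : Type u} [NonUnitalRing J] [Module ℂ J] [IsScalarTower ℂ J J]
    [SMulCommClass ℂ J J] (p : J) (hp : IsIdempotentElem p) : K0 J :=
  ⟨K0Unital.mk (IdemMatrix.single (p : Unitization ℂ J)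
      (by unfold IsIdempotentElem at *; rw [← Unitization.inr_mul, hp])), by
    rw [K0, AddMonoidHom.mem_ker, K0Unital.map_mk,
      ← K0Unital.mk_single_zero (R := ℂ) (by simp [IsIdempotentElem])]
    congr 1⟩

end KTheory

variable {H : Type*} [NormedAddCommGroup H] [InnerProductSpace ℂ H] [CompleteSpace H]

/-! ### Projections -/

/-- `N(S)`, the orthogonal projection onto the kernel of `S`. -/
def kerProj (S : H →L[ℂ] H) : H →L[ℂ] H := S.ker.starProjection

/-- `p ∩ q`, the orthogonal projection onto `Im p ∩ Im q`, for projections `p` and `q`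
(the closure changes nothing then, as the images of projections are closed). -/
def interProj (p q : H →L[ℂ] H) : H →L[ℂ] H :=
  (p.range ⊓ q.range).topologicalClosure.starProjection

/-- `χ(T)` for a bounded self-adjoint operator `T` and the indicator function `χ` of `[0, ∞)`.
The negative part `T⁻ = max(-T, 0)` is a function of `T` that is nonzero exactly on `(-∞, 0)`,
so that `χ(T) = 1 - 1_{(-∞, 0)}(T)` is the projection onto the kernel of `T⁻`.
See `tendsto_cfc_chi` for the agreement with the Borel functional calculus. -/
def chi (T : H →L[ℂ] H) : H →L[ℂ] H := kerProj (cfc (fun t : ℝ => max (-t) 0) T)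

/-- `χ` is the decreasing pointwise limit of the continuous functions `max (1 - n t⁻) 0`, and
`χ(T)` is the strong limit of the operators that the continuous functional calculus assigns
to them. -/
theorem tendsto_cfc_chi (T : H →L[ℂ] H) (hT : IsSelfAdjoint T) (x : H) :
    Filter.Tendsto (fun n : ℕ => cfc (fun t : ℝ => max (1 - n * max (-t) 0) 0) T x)
      Filter.atTop (nhds (chi T x)) := by
  set g : ℝ → ℝ := fun t => max (-t) 0 with hg
  set G : H →L[ℂ] H := cfc g T with hG
  set F : ℕ → H →L[ℂ] H := fun n => cfc (fun t : ℝ => max (1 - n * g t) 0) T with hF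
  have hgc : Continuous g := by fun_prop
  have hg0 : ∀ t, 0 ≤ g t := fun t => le_max_right _ _
  have hGsa : IsSelfAdjoint G := cfc_predicate g T
  have hnorm : ∀ n, ‖F n‖ ≤ 1 := fun n => by
    refine norm_cfc_le zero_le_one fun t _ => ?_
    rw [Real.norm_eq_abs, abs_of_nonneg (le_max_right _ _)]
    refine max_le ?_ zero_le_one
    have := mul_nonneg (Nat.cast_nonneg (α := ℝ) n) (hg0 t)
    linarith
  have hFG : ∀ n : ℕ, ‖F (n + 1) * G‖ ≤ 1 / ((n : ℝ) + 1) := fun n => by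
    have h1 : F (n + 1) * G = cfc (fun t : ℝ => max (1 - ((n + 1 : ℕ) : ℝ) * g t) 0 * g t) T :=
      (cfc_mul (fun t : ℝ => max (1 - ((n + 1 : ℕ) : ℝ) * g t) 0) g T
        (by fun_prop) (by fun_prop)).symm
    have hn : (0 : ℝ) < (n : ℝ) + 1 := by positivity
    rw [h1]
    refine norm_cfc_le (by positivity) fun t _ => ?_
    rw [Real.norm_eq_abs, abs_of_nonneg (mul_nonneg (le_max_right _ _) (hg0 t)), le_div_iff₀ hn]
    push_cast
    rcases le_total (1 - ((n : ℝ) + 1) * g t) 0 with h | h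
    · rw [max_eq_right h]; simp
    · rw [max_eq_left h]
      have := mul_nonneg hn.le (hg0 t)
      nlinarith
  have hF1 : ∀ n : ℕ, ∃ K : H →L[ℂ] H, F (n + 1) = 1 - K * G := fun n => by
    have hn : (0 : ℝ) < (n : ℝ) + 1 := by positivity
    have hpos : ∀ t, 0 < max (g t) (1 / ((n : ℝ) + 1)) := fun t =>
      lt_max_of_lt_right (by positivity)
    have hk : Continuous fun t : ℝ => (max (g t) (1 / ((n : ℝ) + 1)))⁻¹ :=
      (hgc.max continuous_const).inv₀ fun t => (hpos t).ne'
    refine ⟨cfc (fun t : ℝ => (max (g t) (1 / ((n : ℝ) + 1)))⁻¹) T, ?_⟩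
    rw [hG, ← cfc_mul _ g T hk.continuousOn hgc.continuousOn, ← cfc_const_one ℝ T,
      ← cfc_sub (fun _ => (1 : ℝ)) (fun t => (max (g t) (1 / ((n : ℝ) + 1)))⁻¹ * g t) T
        (by fun_prop) (hk.mul hgc).continuousOn]
    refine congrArg (fun f => cfc f T) (funext fun t => ?_)
    push_cast
    rcases le_total (g t) (1 / ((n : ℝ) + 1)) with h | h
    · have h2 := (le_div_iff₀ hn).1 h
      rw [max_eq_right h, max_eq_left (by linarith)]
      simp
    · have h2 := (div_le_iff₀ hn).1 h
      have h3 : 0 < g t := lt_of_lt_of_le (by positivity) h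
      rw [max_eq_left h, max_eq_right (by linarith), inv_mul_cancel₀ h3.ne', sub_self]
  rw [← Filter.tendsto_add_atTop_iff_nat 1]
  have hP : chi T x ∈ G.ker := Submodule.starProjection_apply_mem _ _
  have hz : x - chi T x ∈ G.kerᗮ := Submodule.sub_starProjection_mem_orthogonal x
  rw [ContinuousLinearMap.orthogonal_ker, ← ContinuousLinearMap.star_eq_adjoint,
    hGsa.star_eq] at hz
  have hfix : ∀ n, F (n + 1) (chi T x) = chi T x := fun n => by
    obtain ⟨K, hK⟩ := hF1 n
    have h0 : G (chi T x) = 0 := hP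
    simp [hK, h0]
  rw [Metric.tendsto_atTop]
  intro ε hε
  obtain ⟨w, ⟨y, rfl⟩, hw⟩ := Metric.mem_closure_iff.1 hz (ε / 2) (half_pos hε)
  obtain ⟨m, hm⟩ := exists_nat_gt (‖y‖ / (ε / 2))
  refine ⟨m, fun n hn => ?_⟩
  have hmn : (m : ℝ) ≤ n := by exact_mod_cast hn
  have hpos : (0 : ℝ) < (n : ℝ) + 1 := by positivity
  have e1 : F (n + 1) x - chi T x
      = F (n + 1) (x - chi T x - G y) + (F (n + 1) * G) y := by
    simp [hfix n]
  have e2 : ‖F (n + 1) (x - chi T x - G y)‖ < ε / 2 := by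
    refine lt_of_le_of_lt ((F (n + 1)).le_of_opNorm_le (hnorm _) _) ?_
    rw [one_mul, ← dist_eq_norm]
    exact hw
  have e3 : ‖(F (n + 1) * G) y‖ ≤ ε / 2 := by
    refine ((F (n + 1) * G).le_of_opNorm_le (hFG n) _).trans ?_
    rw [div_mul_eq_mul_div, one_mul, div_le_iff₀ hpos]
    rw [div_lt_iff₀ (half_pos hε)] at hm
    nlinarith
  rw [dist_eq_norm]
  change ‖F (n + 1) x - chi T x‖ < ε
  rw [e1]
  exact (norm_add_le _ _).trans_lt (by linarith)

/-! ### Closed ideals, Fredholm operators and the index -/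

/-- `J` is a norm closed two-sided ideal of the von Neumann algebra `N`. -/
structure IsClosedIdeal (N : VonNeumannAlgebra H) (J : NonUnitalSubalgebra ℂ (H →L[ℂ] H)) :
    Prop where
  le : ∀ x ∈ J, x ∈ N
  mul_mem_left : ∀ a ∈ N, ∀ x ∈ J, a * x ∈ J
  mul_mem_right : ∀ a ∈ N, ∀ x ∈ J, x * a ∈ J
  isClosed : IsClosed (J : Set (H →L[ℂ] H))

/-- The quotient norm `‖π(x)‖ = inf {‖x - j‖ : j ∈ J}` in `N / J`. -/
def quotNorm (J : NonUnitalSubalgebra ℂ (H →L[ℂ] H)) (x : H →L[ℂ] H) : ℝ :=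
  Metric.infDist x (J : Set (H →L[ℂ] H))

/-- `T ∈ N` is `J`-Fredholm: `π(T)` is invertible in `N / J`. -/
def IsJFredholm (N : VonNeumannAlgebra H) (J : NonUnitalSubalgebra ℂ (H →L[ℂ] H))
    (T : H →L[ℂ] H) : Prop :=
  T ∈ N ∧ ∃ S ∈ N, S * T - 1 ∈ J ∧ T * S - 1 ∈ J

/-- `S ∈ qNp` is `(q-p)`-Fredholm: there is a parametrix `T ∈ pNq` with `π(TS) = π(p)` and
`π(ST) = π(q)`. -/
def IsSkewFredholm (N : VonNeumannAlgebra H) (J : NonUnitalSubalgebra ℂ (H →L[ℂ] H))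
    (q p S : H →L[ℂ] H) : Prop :=
  (∃ S' ∈ N, S = q * S' * p) ∧
    ∃ T, (∃ T' ∈ N, T = p * T' * q) ∧ T * S - p ∈ J ∧ S * T - q ∈ J

open Classical in
/-- The class `[p] ∈ K₀(J)` of a projection `p ∈ J` (and `0` for operators that are not
idempotents in `J`). -/
def projClass (J : NonUnitalSubalgebra ℂ (H →L[ℂ] H)) (p : H →L[ℂ] H) : K0 J :=
  if h : p ∈ J ∧ IsIdempotentElem p then
    K0.mk (⟨p, h.1⟩ : J) (Subtype.ext h.2)
  else 0

/-- `Ind_{(q-p)}(S) = [N(S) ∩ p] - [N(S*) ∩ q]`. -/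
def skewIndex (J : NonUnitalSubalgebra ℂ (H →L[ℂ] H)) (q p S : H →L[ℂ] H) : K0 J :=
  projClass J (interProj (kerProj S) p) - projClass J (interProj (kerProj (star S)) q)

/-! ### Spectral flow of paths of bounded operators -/

/-- A norm continuous path of self-adjoint `J`-Fredholm operators in `N`. -/
def IsFredholmPath (N : VonNeumannAlgebra H) (J : NonUnitalSubalgebra ℂ (H →L[ℂ] H))
    (B : I → H →L[ℂ] H) : Prop :=
  Continuous B ∧ ∀ t, IsSelfAdjoint (B t) ∧ IsJFredholm N J (B t)

/-- A partition `0 = t₀ < t₁ < ⋯ < tₙ = 1` such that `‖π(χ(B_s)) - π(χ(B_u))‖ < 1/2` whenever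
`s` and `u` lie in the same interval `[tᵢ₋₁, tᵢ]`. -/
structure FlowPartition (J : NonUnitalSubalgebra ℂ (H →L[ℂ] H)) (B : I → H →L[ℂ] H) where
  n : ℕ
  t : Fin (n + 1) → I
  strictMono : StrictMono t
  t_zero : t 0 = 0
  t_last : t (Fin.last n) = 1
  fine : ∀ i : Fin n, ∀ s ∈ Set.Icc (t i.castSucc) (t i.succ),
    ∀ u ∈ Set.Icc (t i.castSucc) (t i.succ), quotNorm J (chi (B s) - chi (B u)) < 1 / 2

/-- The sum `∑ᵢ [(1 - pᵢ) ∩ pᵢ₋₁] - [(1 - pᵢ₋₁) ∩ pᵢ]`, where `pᵢ = χ(B_{tᵢ})`. -/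
def FlowPartition.flow {J : NonUnitalSubalgebra ℂ (H →L[ℂ] H)} {B : I → H →L[ℂ] H}
    (P : FlowPartition J B) : K0 J :=
  ∑ i : Fin P.n,
    (projClass J (interProj (1 - chi (B (P.t i.succ))) (chi (B (P.t i.castSucc)))) -
     projClass J (interProj (1 - chi (B (P.t i.castSucc))) (chi (B (P.t i.succ)))))

/-- `sf{B_t}` is defined and equal to `c ∈ K₀(J)`: the path `B` is a norm continuous path of
self-adjoint `J`-Fredholm operators, partitions as in the definition of the spectral flow
exist, and for every such partition all the projections in the defining sum lie in `J` and the
sum is `c`. -/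
def HasSpectralFlow (N : VonNeumannAlgebra H) (J : NonUnitalSubalgebra ℂ (H →L[ℂ] H))
    (B : I → H →L[ℂ] H) (c : K0 J) : Prop :=
  IsFredholmPath N J B ∧ Nonempty (FlowPartition J B) ∧
    ∀ P : FlowPartition J B,
      (∀ i : Fin P.n,
        interProj (1 - chi (B (P.t i.succ))) (chi (B (P.t i.castSucc))) ∈ J ∧
        interProj (1 - chi (B (P.t i.castSucc))) (chi (B (P.t i.succ))) ∈ J) ∧
      P.flow = c

/-! ### Unbounded operators -/

/-- `D + A` for a bounded operator `A`, with the domain of `D`. -/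
def perturb (D : H →ₗ.[ℂ] H) (A : H →L[ℂ] H) : H →ₗ.[ℂ] H :=
  (A : H →ₗ[ℂ] H) +ᵥ D

/-- `D²`, with domain `{x ∈ Dom D | D x ∈ Dom D}`. -/
def sqPMap (D : H →ₗ.[ℂ] H) : H →ₗ.[ℂ] H :=
  D.comp (D.domRestrict ((D.domain.comap D.toFun).map D.domain.subtype)) (by
    rintro ⟨x, hx⟩
    obtain ⟨⟨y, hy, rfl⟩, _⟩ := hx
    exact hy)

/-- `R` is the bounded everywhere defined inverse of `T : Dom T → H`. -/
def IsBoundedInverse (T : H →ₗ.[ℂ] H) (R : H →L[ℂ] H) : Prop :=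
  (∀ y, ∃ h : R y ∈ T.domain, T ⟨R y, h⟩ = y) ∧ ∀ x : T.domain, R (T x) = x

open Classical in
/-- The bounded inverse `T⁻¹` of an operator `T : Dom T → H` (and `0` if there is none). -/
def boundedInverse (T : H →ₗ.[ℂ] H) : H →L[ℂ] H :=
  if h : ∃ R, IsBoundedInverse T R then h.choose else 0

theorem boundedInverse_eq {T : H →ₗ.[ℂ] H} {R : H →L[ℂ] H} (hR : IsBoundedInverse T R) :
    boundedInverse T = R := by
  have h : ∃ R, IsBoundedInverse T R := ⟨R, hR⟩
  rw [boundedInverse, dif_pos h]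
  ext y
  obtain ⟨h1, h2⟩ := hR.1 y
  conv_lhs => rw [← h2]
  exact h.choose_spec.2 ⟨R y, h1⟩

open Classical in
/-- The bounded operator `x ↦ D (S x)`, for `S` bounded with `Im S ⊆ Dom D` and `D S` bounded
(and `0` for other `S`). -/
def compBounded (D : H →ₗ.[ℂ] H) (S : H →L[ℂ] H) : H →L[ℂ] H :=
  if h : ∃ F : H →L[ℂ] H, ∀ x, ∃ hx : S x ∈ D.domain, D ⟨S x, hx⟩ = F x then h.choose else 0

theorem compBounded_eq {D : H →ₗ.[ℂ] H} {S F : H →L[ℂ] H}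
    (hF : ∀ x, ∃ hx : S x ∈ D.domain, D ⟨S x, hx⟩ = F x) : compBounded D S = F := by
  have h : ∃ F : H →L[ℂ] H, ∀ x, ∃ hx : S x ∈ D.domain, D ⟨S x, hx⟩ = F x := ⟨F, hF⟩
  rw [compBounded, dif_pos h]
  ext x
  obtain ⟨h1, h2⟩ := hF x
  obtain ⟨h3, h4⟩ := h.choose_spec x
  rw [← h4, ← h2]

/-- The resolvent `(z - D)⁻¹`. -/
def resolventOp (D : H →ₗ.[ℂ] H) (z : ℂ) : H →L[ℂ] H :=
  boundedInverse ((z • LinearMap.id : H →ₗ[ℂ] H) +ᵥ (-D))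

/-- The bounded transform `F_D = D (1 + D²)^(-1/2)`. -/
def boundedTransform (D : H →ₗ.[ℂ] H) : H →L[ℂ] H :=
  compBounded D (CFC.sqrt (boundedInverse ((LinearMap.id : H →ₗ[ℂ] H) +ᵥ sqPMap D)))

/-- `D` is affiliated to `N`: `S D ⊆ D S` for all `S` in the commutant of `N`. -/
def IsAffiliated (N : VonNeumannAlgebra H) (D : H →ₗ.[ℂ] H) : Prop :=
  ∀ S ∈ N.commutant, ∀ x : D.domain, ∃ h : S x ∈ D.domain, D ⟨S x, h⟩ = S (D x)

/-- A von Neumann spectral triple `(𝒜, H, D)` relative to `(N, J)`, where the `*`-algebra `𝒜`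
is represented on `H` by `ρ`. -/
structure IsVNSpectralTriple {𝒜 : Type*} [NonUnitalRing 𝒜] [StarRing 𝒜] [Module ℂ 𝒜]
    (N : VonNeumannAlgebra H) (J : NonUnitalSubalgebra ℂ (H →L[ℂ] H))
    (ρ : 𝒜 →⋆ₙₐ[ℂ] (H →L[ℂ] H)) (D : H →ₗ.[ℂ] H) : Prop where
  isClosedIdeal : IsClosedIdeal N J
  map_mem : ∀ a, ρ a ∈ N
  isSelfAdjoint : IsSelfAdjoint D
  isAffiliated : IsAffiliated N D
  commutator_bounded : ∀ a, ∃ T : H →L[ℂ] H, ∀ x : D.domain,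
    ∃ h : ρ a x ∈ D.domain, D ⟨ρ a x, h⟩ - ρ a (D x) = T x
  resolvent_mem : ∀ z : ℂ, z.im ≠ 0 → ∀ a, ρ a * resolventOp D z ∈ J

/-- The spectral flow of a path `𝒟` of unbounded self-adjoint operators is defined and equal to
`c`: the operators `𝒟 t` are self-adjoint and affiliated to `N`, and `sf{F_{𝒟 t}}` is defined
and equal to `c`. -/
def HasUnboundedSpectralFlow (N : VonNeumannAlgebra H)
    (J : NonUnitalSubalgebra ℂ (H →L[ℂ] H)) (𝒟 : I → H →ₗ.[ℂ] H) (c : K0 J) : Prop :=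
  (∀ t, IsSelfAdjoint (𝒟 t) ∧ IsAffiliated N (𝒟 t)) ∧
    HasSpectralFlow N J (fun t => boundedTransform (𝒟 t)) c

end VNSpectralFlow

end

open scoped unitInterval

noncomputable section

namespace VNSpectralFlow

/-! ### Relative classes in `K₀` -/

section RelativeClass

universe u

/-! The whole path `χ(F_t)`, where `F_t` is the bounded transform of `D_t = D + A_t`, is constant
modulo `J`. All partitions are then admissible, and the sum telescopes.

Analysis. Since some `ρ a` is `1`, the resolvent of `D` lies in `J`, and the resolvent identity
carries this over to each `D_t`. Hence `1 - F_t² = (1 + D_t²)⁻¹` lies in `J`. To compare two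
transforms, write `S = (1 + D²)^(-1/2)` and `F = D S`, with primes for `D + A`. Their difference `X
= F' - F` solves `S' X + X S = S' C S` with `C = A + S' A S - F' A F`
(`boundedTransform_sylvester`). Formally this is `S'⁻¹ X + X S⁻¹ = C`, where the unbounded
coefficients are at least `1`; so `‖X‖ ≤ ‖C‖ / 2 ≤ 3/2 ‖A‖`, which gives norm continuity. On the
spectral subspaces of `S'` and `S` for `[0, δ]` the same argument gives the bound `δ ‖C‖ / 2`,
whereas the smooth cutoffs to the complement lie in `J`, because `S²` and `S'²` do. As `J` is
closed, `X ∈ J` (`mem_of_sylvester`). Finally `χ(F) = (1 + F) / 2` modulo `J` when `F² = 1` modulo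
`J` (`two_chi_sub_mem`), so the spectral projections agree modulo `J`.

K-theory. Fix a base projection `s`. An idempotent `x ∈ s + J` has a relative class in `K₀(J⁺)`,
represented by a `2 × 2` matrix in which `s` has become the scalar matrix `diag(1, 0)`. The polar
decomposition of `q p` shows that `p` and `q`, with `(1 - q) ∩ p` and `(1 - p) ∩ q` removed, are
equivalent within `s + J`. So `[(1 - q) ∩ p] - [(1 - p) ∩ q]` is a difference of relative classes
(`projClass_sub_projClass`), and sums of such terms along a partition depend only on the end points.
-/

theorem K0Unital.mk_eq_add_of_orthogonal {R : Type u} [Ring R] {n : ℕ}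
    {x y z : Matrix (Fin n) (Fin n) R} (hx : IsIdempotentElem x) (hy : IsIdempotentElem y)
    (hz : IsIdempotentElem z) (hxy : x * y = 0) (hyx : y * x = 0) (h : z = x + y) :
    K0Unital.mk ⟨n, z, hz⟩ = K0Unital.mk ⟨n, x, hx⟩ + K0Unital.mk ⟨n, y, hy⟩ := by
  -- The row `(x y)` times the column with the same entries is `x + y`; in the other order the
  -- off-diagonal blocks `x y` and `y x` vanish.
  have h1 : (Matrix.fromCols x y).submatrix id finSumFinEquiv.symm *
      (Matrix.fromRows x y).submatrix finSumFinEquiv.symm id = z := by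
    rw [Matrix.submatrix_mul_equiv, Matrix.fromCols_mul_fromRows, hx.eq, hy.eq, h,
      Matrix.submatrix_id_id]
  have h2 : (Matrix.fromRows x y).submatrix finSumFinEquiv.symm id *
      (Matrix.fromCols x y).submatrix id finSumFinEquiv.symm = blockSum x y := by
    rw [← Matrix.submatrix_mul _ _ _ id _ Function.bijective_id, Matrix.fromRows_mul_fromCols,
      hx.eq, hy.eq, hxy, hyx]
    rfl
  rw [← K0Unital.mk_sum]
  exact K0Unital.mk_eq_of_equiv ⟨_, _, h1, h2⟩

variable {A : Type u} [Ring A] [Algebra ℂ A]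

theorem unitization_ext {J : NonUnitalSubalgebra ℂ A} {x y : Unitization ℂ J}
    (h₁ : x.fst = y.fst) (h₂ : (x.snd : A) = y.snd) : x = y :=
  Unitization.ext h₁ (Subtype.ext h₂)

/-- `s` is an idempotent multiplier of the algebra `J`. -/
structure IsIdemMultiplier (J : NonUnitalSubalgebra ℂ A) (s : A) : Prop where
  idem : s * s = s
  left : ∀ x ∈ J, s * x ∈ J
  right : ∀ x ∈ J, x * s ∈ J

namespace IsIdemMultiplier

variable {J : NonUnitalSubalgebra ℂ A} {s : A} (hs : IsIdemMultiplier J s)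
include hs

theorem left_compl {x : A} (hx : x ∈ J) : (1 - s) * x ∈ J := by
  rw [sub_mul, one_mul]; exact J.sub_mem hx (hs.left x hx)

theorem right_compl {x : A} (hx : x ∈ J) : x * (1 - s) ∈ J := by
  rw [mul_sub, mul_one]; exact J.sub_mem hx (hs.right x hx)

theorem idem_assoc (x : A) : s * (s * x) = s * x := by rw [← mul_assoc, hs.idem]

/-- The matrix of `j ∈ J` with respect to the decomposition `1 = s + (1 - s)`. -/
def corner (j : J) : Matrix (Fin 2) (Fin 2) (Unitization ℂ J) :=
  !![((⟨s * j * s, hs.right _ (hs.left _ j.2)⟩ : J) : Unitization ℂ J),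
     ((⟨s * j * (1 - s), hs.right_compl (hs.left _ j.2)⟩ : J) : Unitization ℂ J);
     ((⟨(1 - s) * j * s, hs.right _ (hs.left_compl j.2)⟩ : J) : Unitization ℂ J),
     ((⟨(1 - s) * j * (1 - s), hs.right_compl (hs.left_compl j.2)⟩ : J) : Unitization ℂ J)]

/-- The matrix over `J⁺` that represents `s + j`, with `s` replaced by the scalar matrix
`diag(1, 0)`. -/
def relMatrix (j : J) : Matrix (Fin 2) (Fin 2) (Unitization ℂ J) :=
  !![1, 0; 0, 0] + hs.corner j

/-- With `u` the column `(s, 1 - s)` and `u'` the row with the same entries, `u' u = 1` and `corner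
j` is `u j u'`. Moreover `diag(1, 0)` multiplies corners exactly as `s` multiplies `J`, so the
replacement of `s` by a scalar matrix preserves products. -/
theorem relMatrix_mul {i j k : J} (h : (s + i) * (s + j) = s + (k : A)) :
    hs.relMatrix i * hs.relMatrix j = hs.relMatrix k := by
  have hk : (k : A) = s * j + i * s + i * j := by
    rw [add_mul, mul_add, mul_add, hs.idem] at h
    have := add_left_cancel (a := s) (b := s * (j : A) + (i * s + i * j)) (c := k)
      (by rw [← h]; abel)
    rw [← this]; abel
  have h1 := hs.idem
  have h2 := hs.idem_assoc
  refine Matrix.ext fun p q => ?_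
  fin_cases p <;> fin_cases q <;>
  refine unitization_ext ?_ ?_ <;>
  simp [relMatrix, corner, Matrix.mul_apply, Fin.sum_univ_two, hk] <;>
  simp only [mul_add, add_mul, mul_sub, sub_mul, mul_assoc, one_mul, mul_one, h1, h2] <;> abel

theorem corner_mul {i j k : J} (h : (i : A) * j = k) :
    hs.corner i * hs.corner j = hs.corner k := by
  have h2 := hs.idem_assoc
  refine Matrix.ext fun p q => ?_
  fin_cases p <;> fin_cases q <;>
  refine unitization_ext ?_ ?_ <;>
  simp [corner, Matrix.mul_apply, Fin.sum_univ_two, ← h] <;>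
  simp only [mul_sub, sub_mul, mul_assoc, one_mul, mul_one, h2] <;> abel

theorem relMatrix_mul_corner {i j k : J} (h : (s + i) * (j : A) = k) :
    hs.relMatrix i * hs.corner j = hs.corner k := by
  have h2 := hs.idem_assoc
  refine Matrix.ext fun p q => ?_
  fin_cases p <;> fin_cases q <;>
  refine unitization_ext ?_ ?_ <;>
  simp [relMatrix, corner, Matrix.mul_apply, Fin.sum_univ_two, ← h] <;>
  simp only [mul_add, add_mul, mul_sub, sub_mul, mul_assoc, one_mul, mul_one, h2] <;> abel

theorem corner_mul_relMatrix {i j k : J} (h : (j : A) * (s + i) = k) :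
    hs.corner j * hs.relMatrix i = hs.corner k := by
  have h1 := hs.idem
  have h2 := hs.idem_assoc
  refine Matrix.ext fun p q => ?_
  fin_cases p <;> fin_cases q <;>
  refine unitization_ext ?_ ?_ <;>
  simp [relMatrix, corner, Matrix.mul_apply, Fin.sum_univ_two, ← h] <;>
  simp only [mul_add, add_mul, mul_sub, sub_mul, mul_assoc, one_mul, mul_one, h1, h2] <;> abel

theorem relMatrix_add (i j : J) : hs.relMatrix (i + j) = hs.relMatrix i + hs.corner j := by
  rw [relMatrix, relMatrix, add_assoc]
  congr 1
  refine Matrix.ext fun p q => ?_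
  fin_cases p <;> fin_cases q <;>
  refine unitization_ext ?_ ?_ <;>
  simp [corner, mul_add, add_mul]

theorem corner_zero : hs.corner 0 = 0 := by
  refine Matrix.ext fun p q => ?_
  fin_cases p <;> fin_cases q <;>
  refine unitization_ext ?_ ?_ <;>
  simp [corner]

theorem corner_idem {e : J} (he : IsIdempotentElem e) : IsIdempotentElem (hs.corner e) :=
  hs.corner_mul (congrArg Subtype.val he.eq)

/-- The column `u e` and the row `e u'`, with `u = (s, 1 - s)`, have products `u e u'` and `e u' u e
= e`. -/
theorem mk_corner {e : J} (he : IsIdempotentElem e) :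
    K0Unital.mk ⟨2, hs.corner e, hs.corner_idem he⟩ =
      (K0.mk e he : K0Unital (Unitization ℂ J)) := by
  have h2 := hs.idem_assoc
  have he' : (e : A) * e = e := congrArg Subtype.val he.eq
  have he2 (x : A) : (e : A) * (e * x) = e * x := by rw [← mul_assoc, he']
  have hab : (!![((⟨s * e, hs.left _ e.2⟩ : J) : Unitization ℂ J);
      ((⟨(1 - s) * e, hs.left_compl e.2⟩ : J) : Unitization ℂ J)] :
        Matrix (Fin 2) (Fin 1) (Unitization ℂ J)) *
      (!![((⟨e * s, hs.right _ e.2⟩ : J) : Unitization ℂ J),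
      ((⟨e * (1 - s), hs.right_compl e.2⟩ : J) : Unitization ℂ J)] :
        Matrix (Fin 1) (Fin 2) (Unitization ℂ J)) = hs.corner e := by
    refine Matrix.ext fun p q => ?_
    fin_cases p <;> fin_cases q <;>
    refine unitization_ext ?_ ?_ <;>
    simp [corner, Matrix.mul_apply] <;>
    simp only [mul_sub, sub_mul, mul_assoc, he', he2, mul_one, one_mul]
  have hba : (!![((⟨e * s, hs.right _ e.2⟩ : J) : Unitization ℂ J),
      ((⟨e * (1 - s), hs.right_compl e.2⟩ : J) : Unitization ℂ J)] :
        Matrix (Fin 1) (Fin 2) (Unitization ℂ J)) *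
      (!![((⟨s * e, hs.left _ e.2⟩ : J) : Unitization ℂ J);
      ((⟨(1 - s) * e, hs.left_compl e.2⟩ : J) : Unitization ℂ J)] :
        Matrix (Fin 2) (Fin 1) (Unitization ℂ J)) =
      Matrix.of fun _ _ => (e : Unitization ℂ J) := by
    refine Matrix.ext fun p q => ?_
    refine unitization_ext (by simp [Matrix.mul_apply, Fin.sum_univ_two]) ?_
    simp [Matrix.mul_apply, Fin.sum_univ_two]
    simp only [mul_sub, sub_mul, mul_assoc, h2, he', mul_one, one_mul]
    abel
  exact K0Unital.mk_eq_of_equiv ⟨_, _, hab, hba⟩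

theorem relMatrix_idem {x : A} (hx : x - s ∈ J) (hi : IsIdempotentElem x) :
    IsIdempotentElem (hs.relMatrix ⟨x - s, hx⟩) :=
  hs.relMatrix_mul (by simpa using hi.eq)

/-- The relative class in `K₀(J⁺)` of an idempotent `x ∈ s + J`. -/
def relClass {x : A} (hx : x - s ∈ J) (hi : IsIdempotentElem x) : K0Unital (Unitization ℂ J) :=
  K0Unital.mk ⟨2, hs.relMatrix ⟨x - s, hx⟩, hs.relMatrix_idem hx hi⟩

theorem relClass_eq_of_equiv {x y a b : A} (hx : x - s ∈ J) (hix : IsIdempotentElem x)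
    (hy : y - s ∈ J) (hiy : IsIdempotentElem y) (ha : a - s ∈ J) (hb : b - s ∈ J)
    (hab : a * b = x) (hba : b * a = y) : hs.relClass hx hix = hs.relClass hy hiy :=
  K0Unital.mk_eq_of_equiv ⟨hs.relMatrix ⟨a - s, ha⟩, hs.relMatrix ⟨b - s, hb⟩,
    hs.relMatrix_mul (by simpa using hab), hs.relMatrix_mul (by simpa using hba)⟩

theorem relClass_eq_add {x y : A} {e : J} (hx : x - s ∈ J) (hix : IsIdempotentElem x)
    (hy : y - s ∈ J) (hiy : IsIdempotentElem y) (he : IsIdempotentElem e)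
    (h : x = y + e) (hye : y * e = 0) (hey : e * y = 0) :
    hs.relClass hx hix = hs.relClass hy hiy + K0.mk e he := by
  rw [← hs.mk_corner he]
  refine K0Unital.mk_eq_add_of_orthogonal _ _ _ ?_ ?_ ?_
  · rw [hs.relMatrix_mul_corner (k := 0) (by simpa using hye), hs.corner_zero]
  · rw [hs.corner_mul_relMatrix (k := 0) (by simpa using hey), hs.corner_zero]
  · rw [← hs.relMatrix_add]
    congr 1
    exact Subtype.ext (by simp [h]; abel)

end IsIdemMultiplier
end RelativeClass

variable {H : Type*} [NormedAddCommGroup H] [InnerProductSpace ℂ H] [CompleteSpace H]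

/-! ### Membership in von Neumann algebras and kernel projections -/

theorem mem_of_commute_commutant {N : VonNeumannAlgebra H} {a : H →L[ℂ] H}
    (h : ∀ T ∈ N.commutant, T * a = a * T) : a ∈ N := by
  rw [← N.commutant_commutant]
  exact VonNeumannAlgebra.mem_commutant_iff.2 h

theorem commutant_commute {N : VonNeumannAlgebra H} {a T : H →L[ℂ] H} (ha : a ∈ N)
    (hT : T ∈ N.commutant) : Commute T a :=
  (VonNeumannAlgebra.mem_commutant_iff.1 hT a ha).symm

theorem cfc_mem {N : VonNeumannAlgebra H} {a : H →L[ℂ] H} (ha : a ∈ N) (f : ℝ → ℝ) :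
    cfc f a ∈ N :=
  mem_of_commute_commutant fun _ hT => ((commutant_commute ha hT).symm.cfc_real f).symm

theorem starProjection_mem {N : VonNeumannAlgebra H} (K : Submodule ℂ H) [K.HasOrthogonalProjection]
    (h : ∀ T ∈ N.commutant, ∀ x ∈ K, T x ∈ K) : K.starProjection ∈ N := by
  refine (VonNeumannAlgebra.IsStarProjection.mem_iff isStarProjection_starProjection N).2
    fun T hT => ?_
  rw [Submodule.range_starProjection]
  exact fun x hx => h T hT x hx

theorem kerProj_mem {N : VonNeumannAlgebra H} {S : H →L[ℂ] H} (hS : S ∈ N) : kerProj S ∈ N := by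
  refine starProjection_mem _ fun T hT x hx => ?_
  have h := congrArg (fun A : H →L[ℂ] H => A x) (commutant_commute hS hT).eq
  have hx' : S x = 0 := hx
  simp only [mul_apply_eq_comp, hx', map_zero] at h
  exact h.symm

theorem interProj_mem {N : VonNeumannAlgebra H} {p q : H →L[ℂ] H} (hp : p ∈ N) (hq : q ∈ N) :
    interProj p q ∈ N := by
  refine starProjection_mem _ fun T hT x hx => ?_
  refine map_mem_closure (s := ((p.range ⊓ q.range : Submodule ℂ H) : Set H)) T.continuous hx ?_
  rintro _ ⟨⟨y, rfl⟩, ⟨z, hz⟩⟩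
  refine ⟨⟨T y, ?_⟩, ⟨T z, ?_⟩⟩
  · exact congrArg (fun A : H →L[ℂ] H => A y) (commutant_commute hp hT).eq.symm
  · rw [← hz]
    exact congrArg (fun A : H →L[ℂ] H => A z) (commutant_commute hq hT).eq.symm

theorem isStarProjection_kerProj (S : H →L[ℂ] H) : IsStarProjection (kerProj S) :=
  isStarProjection_starProjection

theorem isStarProjection_interProj (p q : H →L[ℂ] H) : IsStarProjection (interProj p q) :=
  isStarProjection_starProjection

theorem mul_kerProj (S : H →L[ℂ] H) : S * kerProj S = 0 := by
  ext x
  exact Submodule.starProjection_apply_mem S.ker x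

theorem kerProj_apply_of_eq_zero {S : H →L[ℂ] H} {x : H} (h : S x = 0) : kerProj S x = x :=
  Submodule.starProjection_eq_self_iff.2 h

theorem kerProj_mul_of_mul_eq_zero {S T : H →L[ℂ] H} (h : S * T = 0) : kerProj S * T = T := by
  ext x
  exact kerProj_apply_of_eq_zero (congrArg (fun A : H →L[ℂ] H => A x) h)

theorem kerProj_star_mul (S : H →L[ℂ] H) : kerProj (star S) * S = 0 := by
  have h := congrArg star (mul_kerProj (star S))
  rwa [star_mul, star_star, star_zero, (isStarProjection_kerProj _).isSelfAdjoint.star_eq] at h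

theorem kerProj_eq_of_isSelfAdjoint {S Q : H →L[ℂ] H} (hQ : IsSelfAdjoint Q) (h₁ : S * Q = 0)
    (h₂ : Q * kerProj S = kerProj S) : kerProj S = Q := by
  have h := congrArg star (kerProj_mul_of_mul_eq_zero h₁)
  rw [star_mul, hQ.star_eq, (isStarProjection_kerProj _).isSelfAdjoint.star_eq, h₂] at h
  exact h

/-- The closure of the range of `S` and the kernel of `S*` are orthogonal complements. -/
theorem eq_zero_of_mul_eq_zero {W S : H →L[ℂ] H} (h₁ : W * S = 0)
    (h₂ : W * kerProj (star S) = 0) : W = 0 := by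
  ext x
  have hz : x - kerProj (star S) x ∈ (star S).kerᗮ := Submodule.sub_starProjection_mem_orthogonal x
  rw [ContinuousLinearMap.orthogonal_ker, ← ContinuousLinearMap.star_eq_adjoint, star_star] at hz
  have hc : S.range.topologicalClosure ≤ W.ker := by
    refine Submodule.topologicalClosure_minimal _ ?_ W.isClosed_ker
    rintro _ ⟨y, rfl⟩
    exact congrArg (fun A : H →L[ℂ] H => A y) h₁
  have h3 : W (x - kerProj (star S) x) = 0 := hc hz
  rw [map_sub, sub_eq_zero] at h3
  rw [h3]
  exact congrArg (fun A : H →L[ℂ] H => A x) h₂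

theorem eq_of_mul_eq_mul {V W S : H →L[ℂ] H} (h₁ : V * S = W * S)
    (h₂ : V * kerProj (star S) = W * kerProj (star S)) : V = W :=
  sub_eq_zero.1 (eq_zero_of_mul_eq_zero (S := S) (by rw [sub_mul, h₁, sub_self])
    (by rw [sub_mul, h₂, sub_self]))

/-! ### Polar decomposition -/

theorem norm_abs_apply (T : H →L[ℂ] H) (x : H) : ‖CFC.abs T x‖ = ‖T x‖ := by
  have h (S : H →L[ℂ] H) : ‖S x‖ ^ 2 = RCLike.re (inner ℂ ((star S * S) x) x) := by
    rw [ContinuousLinearMap.star_eq_adjoint]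
    exact S.apply_norm_sq_eq_inner_adjoint_left x
  have h1 := h (CFC.abs T)
  rw [(CFC.abs_nonneg T).isSelfAdjoint.star_eq, CFC.abs_mul_abs, ← h T] at h1
  exact (sq_eq_sq₀ (norm_nonneg _) (norm_nonneg _)).1 h1

theorem kerProj_abs (T : H →L[ℂ] H) : kerProj (CFC.abs T) = kerProj T := by
  have : (CFC.abs T).ker = T.ker := by
    ext x
    change CFC.abs T x = 0 ↔ T x = 0
    rw [← norm_eq_zero, norm_abs_apply, norm_eq_zero]
  simp only [kerProj, this]

/-- The assignment `|T| x ↦ T x` is isometric, so it extends to the closure `K` of the range of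
`|T|`. Composition with the projection onto `K` makes it vanish on `ker T`. -/
theorem exists_polar_aux (T : H →L[ℂ] H) :
    ∃ v : H →L[ℂ] H, v * CFC.abs T = T ∧ v * kerProj T = 0 := by
  set R := CFC.abs T with hR
  set K := R.range.topologicalClosure with hK
  let R' : H →ₗ[ℂ] K := (R : H →ₗ[ℂ] H).codRestrict K fun x => R.range.le_topologicalClosure ⟨x, rfl⟩
  have hd : DenseRange R' := by
    intro y
    rw [Metric.mem_closure_iff]
    intro ε hε
    obtain ⟨_, ⟨x, rfl⟩, hx⟩ := Metric.mem_closure_iff.1 y.2 ε hε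
    exact ⟨R' x, ⟨x, rfl⟩, hx⟩
  have hn : ∃ C, ∀ x, ‖(T : H →ₗ[ℂ] H) x‖ ≤ C * ‖R' x‖ :=
    ⟨1, fun x => by rw [one_mul]; exact (norm_abs_apply T x).ge⟩
  refine ⟨((T : H →ₗ[ℂ] H).extendOfNorm R').comp K.orthogonalProjectionOnto, ?_, ?_⟩
  · ext x
    have : K.orthogonalProjectionOnto (R x) = R' x :=
      Submodule.orthogonalProjectionOnto_mem_subspace_eq_self (R' x)
    simp only [mul_apply_eq_comp, ContinuousLinearMap.comp_apply, this]
    exact LinearMap.extendOfNorm_eq hd hn x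
  · ext x
    have hx : kerProj T x ∈ Kᗮ := by
      rw [← kerProj_abs, hK, Submodule.orthogonal_closure, ContinuousLinearMap.orthogonal_range,
        ← ContinuousLinearMap.star_eq_adjoint, (CFC.abs_nonneg T).isSelfAdjoint.star_eq]
      exact Submodule.starProjection_apply_mem _ _
    simp only [mul_apply_eq_comp, ContinuousLinearMap.comp_apply,
      Submodule.orthogonalProjectionOnto_apply_of_mem_orthogonal hx, map_zero]
    rfl

/-- The polar decomposition `T = v |T|` in a von Neumann algebra. -/
theorem exists_polar {N : VonNeumannAlgebra H} {T : H →L[ℂ] H} (hT : T ∈ N) :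
    ∃ v ∈ N, v * CFC.abs T = T ∧ v * kerProj T = 0 ∧ star v * v = 1 - kerProj T ∧
      v * star v = 1 - kerProj (star T) := by
  obtain ⟨v, h1, h2⟩ := exists_polar_aux T
  have hsa : star (CFC.abs T) = CFC.abs T := (CFC.abs_nonneg T).isSelfAdjoint.star_eq
  have hk : kerProj (star (CFC.abs T)) = kerProj T := by rw [hsa, kerProj_abs]
  have hRk : CFC.abs T * kerProj T = 0 := by rw [← kerProj_abs, mul_kerProj]
  have hkR : kerProj T * CFC.abs T = 0 := by
    have := kerProj_star_mul (CFC.abs T)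
    rwa [hk] at this
  -- The identities for `v` are tested on the range of `|T|` and on `ker T`; the one for `v v*` is
  -- tested on the range of `T` and on `ker T*`.
  have hTv : star T * v = CFC.abs T := by
    refine eq_of_mul_eq_mul (S := CFC.abs T) ?_ ?_
    · rw [mul_assoc, h1, CFC.abs_mul_abs]
    · rw [hk, mul_assoc, h2, hRk, mul_zero]
  have hvT : star v * T = CFC.abs T := by
    simpa [hsa] using congrArg star hTv
  have hkv : kerProj (star T) * v = 0 := by
    refine eq_zero_of_mul_eq_zero (S := CFC.abs T) ?_ ?_
    · rw [mul_assoc, h1, kerProj_star_mul]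
    · rw [hk, mul_assoc, h2, mul_zero]
  have hvk : star v * kerProj (star T) = 0 := by
    simpa [(isStarProjection_kerProj (star T)).isSelfAdjoint.star_eq] using congrArg star hkv
  refine ⟨v, mem_of_commute_commutant fun S hS => ?_, h1, h2, ?_, ?_⟩
  · have c1 := commutant_commute hT hS
    have c3 : Commute S (CFC.abs T) :=
      (c1.symm.cfcAbs_left (commutant_commute hT (star_mem hS)).symm).symm
    have c4 : Commute S (kerProj T) := commutant_commute (kerProj_mem hT) hS
    refine eq_of_mul_eq_mul (S := CFC.abs T) ?_ ?_
    · rw [mul_assoc, h1, c1.eq, mul_assoc, c3.eq, ← mul_assoc, h1]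
    · rw [hk, mul_assoc, h2, mul_zero, mul_assoc, c4.eq, ← mul_assoc, h2, zero_mul]
  · refine eq_of_mul_eq_mul (S := CFC.abs T) ?_ ?_
    · rw [mul_assoc, h1, hvT, sub_mul, one_mul, hkR, sub_zero]
    · rw [hk, mul_assoc, h2, mul_zero, sub_mul, one_mul,
        (isStarProjection_kerProj T).isIdempotentElem.eq, sub_self]
  · refine eq_of_mul_eq_mul (S := T) ?_ ?_
    · rw [mul_assoc, hvT, h1, sub_mul, one_mul, kerProj_star_mul, sub_zero]
    · rw [mul_assoc, hvk, mul_zero, sub_mul, one_mul,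
        (isStarProjection_kerProj _).isIdempotentElem.eq, sub_self]

/-! ### The relative index of two projections -/

theorem mul_interProj_left {p q : H →L[ℂ] H} (hp : IsStarProjection p) :
    p * interProj p q = interProj p q := by
  ext x
  have hc : (p.range ⊓ q.range).topologicalClosure ≤ (1 - p).ker := by
    refine Submodule.topologicalClosure_minimal _ ?_ (1 - p).isClosed_ker
    rintro _ ⟨⟨y, rfl⟩, -⟩
    have := congrArg (fun A : H →L[ℂ] H => A y) hp.isIdempotentElem.eq
    exact sub_eq_zero.2 this.symm
  have h : (1 - p) (interProj p q x) = 0 := hc (Submodule.starProjection_apply_mem _ x)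
  exact (sub_eq_zero.1 h).symm

theorem interProj_mul_of_mul_eq {p q T : H →L[ℂ] H} (hp : p * T = T) (hq : q * T = T) :
    interProj p q * T = T := by
  ext x
  refine Submodule.starProjection_eq_self_iff.2 (Submodule.le_topologicalClosure _ ?_)
  exact ⟨⟨T x, congrArg (fun A : H →L[ℂ] H => A x) hp⟩,
    ⟨T x, congrArg (fun A : H →L[ℂ] H => A x) hq⟩⟩

theorem mul_interProj_right {p q : H →L[ℂ] H} (hq : IsStarProjection q) :
    q * interProj p q = interProj p q := by
  ext x
  have hc : (p.range ⊓ q.range).topologicalClosure ≤ (1 - q).ker := by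
    refine Submodule.topologicalClosure_minimal _ ?_ (1 - q).isClosed_ker
    rintro _ ⟨-, ⟨y, rfl⟩⟩
    have := congrArg (fun A : H →L[ℂ] H => A y) hq.isIdempotentElem.eq
    exact sub_eq_zero.2 this.symm
  have h : (1 - q) (interProj p q x) = 0 := hc (Submodule.starProjection_apply_mem _ x)
  exact (sub_eq_zero.1 h).symm

theorem mul_interProj_compl {p q : H →L[ℂ] H} (hq : IsStarProjection q) :
    q * interProj (1 - q) p = 0 := by
  have h := mul_interProj_left (q := p) hq.one_sub
  rw [sub_mul, one_mul, sub_eq_self] at h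
  exact h

/-- The kernel of `q p` is the orthogonal sum of `ker p` and `Im p ∩ ker q`. -/
theorem kerProj_mul {p q : H →L[ℂ] H} (hp : IsStarProjection p) (hq : IsStarProjection q) :
    kerProj (q * p) = 1 - p + interProj (1 - q) p := by
  have he := isStarProjection_interProj (1 - q) p
  have hpe := mul_interProj_right (p := 1 - q) hp
  have hep : interProj (1 - q) p * p = interProj (1 - q) p := by
    simpa [hp.isSelfAdjoint.star_eq, he.isSelfAdjoint.star_eq] using congrArg star hpe
  refine kerProj_eq_of_isSelfAdjoint (hp.one_sub.isSelfAdjoint.add he.isSelfAdjoint) ?_ ?_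
  · rw [mul_add, mul_assoc, mul_assoc, hpe, mul_interProj_compl hq, mul_sub, mul_one,
      hp.isIdempotentElem.eq, sub_self, mul_zero, add_zero]
  · have h1 : interProj (1 - q) p * (p * kerProj (q * p)) = p * kerProj (q * p) := by
      refine interProj_mul_of_mul_eq ?_ ?_
      · rw [sub_mul, one_mul, ← mul_assoc q, mul_kerProj, sub_zero]
      · rw [← mul_assoc, hp.isIdempotentElem.eq]
    rw [← mul_assoc, hep] at h1
    rw [add_mul, h1, sub_mul, one_mul, sub_add_cancel]

/-- The absolute value only serves to make the function continuous on all of `ℝ`; the spectrum of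
`R` is nonnegative. -/
theorem one_add_mul_cfc_inv {R : H →L[ℂ] H} (hR : 0 ≤ R) :
    (1 + R) * cfc (fun t : ℝ => (1 + |t|)⁻¹) R = 1 := by
  have hRsa : IsSelfAdjoint R := hR.isSelfAdjoint
  have hc : Continuous (fun t : ℝ => (1 + |t|)⁻¹) :=
    Continuous.inv₀ (by fun_prop) fun t => by positivity
  have h1 : 1 + R = cfc (fun t : ℝ => 1 + t) R := by
    rw [cfc_const_add 1 (fun t : ℝ => t) R, cfc_id' ℝ R, map_one]
  rw [h1, ← cfc_mul _ _ R (by fun_prop) hc.continuousOn, ← cfc_one ℝ R]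
  refine cfc_congr fun t ht => ?_
  have ht0 : 0 ≤ t := spectrum_nonneg_of_nonneg hR ht
  change (1 + t) * (1 + |t|)⁻¹ = 1
  rw [abs_of_nonneg ht0]
  exact mul_inv_cancel₀ (by positivity)

namespace IsClosedIdeal

variable {N : VonNeumannAlgebra H} {J : NonUnitalSubalgebra ℂ (H →L[ℂ] H)} (hJ : IsClosedIdeal N J)
include hJ

theorem isIdemMultiplier {s : H →L[ℂ] H} (hs : s ∈ N) (hi : IsIdempotentElem s) :
    IsIdemMultiplier J s :=
  ⟨hi.eq, hJ.mul_mem_left s hs, hJ.mul_mem_right s hs⟩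

theorem interProj_mem {p q : H →L[ℂ] H} (hp : IsStarProjection p) (hq : IsStarProjection q)
    (hpN : p ∈ N) (hqN : q ∈ N) (hpq : p - q ∈ J) : interProj (1 - q) p ∈ J := by
  have hqe := congrArg star (mul_interProj_compl (p := p) hq)
  have hpe := congrArg star (mul_interProj_right (p := 1 - q) hp)
  rw [star_mul, (isStarProjection_interProj _ _).isSelfAdjoint.star_eq, hq.isSelfAdjoint.star_eq,
    star_zero] at hqe
  rw [star_mul, (isStarProjection_interProj _ _).isSelfAdjoint.star_eq,
    hp.isSelfAdjoint.star_eq] at hpe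
  rw [← hpe, ← sub_zero (_ * p), ← hqe, ← mul_sub]
  exact hJ.mul_mem_left _ (VNSpectralFlow.interProj_mem (sub_mem (one_mem N) hqN) hpN) _ hpq

/-- Projections that agree modulo `J` are, up to projections in `J`, equivalent by a partial
isometry that agrees with them modulo `J`. -/
theorem exists_partialIsometry {p q : H →L[ℂ] H}
    (hp : IsStarProjection p) (hq : IsStarProjection q) (hpN : p ∈ N) (hqN : q ∈ N)
    (hpq : p - q ∈ J) :
    ∃ v : H →L[ℂ] H, star v - p ∈ J ∧ v - p ∈ J ∧ star v * v = p - interProj (1 - q) p ∧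
      v * star v = q - interProj (1 - p) q := by
  have hqp : q - p ∈ J := by simpa using J.neg_mem hpq
  have hT : q * p ∈ N := mul_mem hqN hpN
  have hTs : star (q * p) = p * q := by
    rw [star_mul, hp.isSelfAdjoint.star_eq, hq.isSelfAdjoint.star_eq]
  obtain ⟨v, hvN, hv, hvk, hvv, hvv'⟩ := exists_polar hT
  rw [kerProj_mul hp hq] at hvv
  rw [hTs, kerProj_mul hq hp] at hvv'
  set R := CFC.abs (q * p) with hR
  have hRsa : IsSelfAdjoint R := (CFC.abs_nonneg _).isSelfAdjoint
  have hRN : R ∈ N := by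
    refine mem_of_commute_commutant fun S hS => ?_
    exact ((commutant_commute hT hS).symm.cfcAbs_left
      (commutant_commute hT (star_mem hS)).symm).symm
  have hkp : kerProj (q * p) * (1 - p) = 1 - p :=
    kerProj_mul_of_mul_eq_zero (by rw [mul_assoc, mul_sub, mul_one, hp.isIdempotentElem.eq,
      sub_self, mul_zero])
  have hvp : v * p = v := by
    have : v * (1 - p) = 0 := by rw [← hkp, ← mul_assoc, hvk, zero_mul]
    rw [mul_sub, mul_one, sub_eq_zero] at this
    exact this.symm
  have hRp : R * p = R := by
    have : R * (1 - p) = 0 := by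
      rw [← hkp, ← mul_assoc, hR, ← kerProj_abs, mul_kerProj, zero_mul]
    rw [mul_sub, mul_one, sub_eq_zero] at this
    exact this.symm
  have hpR : p * R = R := by
    simpa [hp.isSelfAdjoint.star_eq, hRsa.star_eq] using congrArg star hRp
  -- Since `p R = R` and `R² = p q p`, the product `(p - R)(1 + R)` equals `p (p - q) p ∈ J`, and
  -- the invertible factor `1 + R` can be cancelled.
  have hpRJ : p - R ∈ J := by
    have hG := one_add_mul_cfc_inv (CFC.abs_nonneg (q * p))
    rw [← hR] at hG
    have h7 : (p - R) * (1 + R) ∈ J := by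
      have : (p - R) * (1 + R) = p * (p - q) * p := by
        have h8 : R * R = p * q * (q * p) := by rw [hR, CFC.abs_mul_abs, hTs]
        rw [mul_assoc p q, ← mul_assoc q q, hq.isIdempotentElem.eq] at h8
        rw [mul_add, mul_one, sub_mul, hpR, h8, mul_sub, sub_mul, hp.isIdempotentElem.eq,
          hp.isIdempotentElem.eq, mul_assoc]
        abel
      rw [this]
      exact hJ.mul_mem_right _ hpN _ (hJ.mul_mem_left _ hpN _ hpq)
    have h9 := hJ.mul_mem_right _ (cfc_mem hRN fun t : ℝ => (1 + |t|)⁻¹) _ h7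
    rwa [mul_assoc, hG, mul_one] at h9
  -- From `v p = v` and `v R = q p` follows `v - p = v (p - R) + (q - p) p`; the adjoint splits in
  -- the same way.
  refine ⟨v, ?_, ?_, ?_, ?_⟩
  · have h7 := hJ.mul_mem_right _ (star_mem hvN) _ hpRJ
    have h8 : star v - p = (p - R) * star v + p * (q - p) := by
      have e1 : p * star v = star v := by
        simpa [hp.isSelfAdjoint.star_eq] using congrArg star hvp
      have e2 : R * star v = p * q := by
        simpa [hRsa.star_eq, hp.isSelfAdjoint.star_eq, hq.isSelfAdjoint.star_eq]
          using congrArg star hv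
      rw [sub_mul, e1, e2, mul_sub, hp.isIdempotentElem.eq]
      abel
    rw [h8]
    exact J.add_mem h7 (hJ.mul_mem_left _ hpN _ hqp)
  · have h7 := hJ.mul_mem_left _ hvN _ hpRJ
    have h8 : v - p = v * (p - R) + (q - p) * p := by
      rw [mul_sub, hvp, hv, sub_mul, hp.isIdempotentElem.eq]
      abel
    rw [h8]
    exact J.add_mem h7 (hJ.mul_mem_right _ hpN _ hqp)
  · rw [hvv]; abel
  · rw [hvv']; abel

/-- The relative classes of two projections that agree modulo `J` differ by
`[(1 - q) ∩ p] - [(1 - p) ∩ q]`. -/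
theorem projClass_sub_projClass {s p q : H →L[ℂ] H} (hs : IsIdemMultiplier J s)
    (hp : IsStarProjection p) (hq : IsStarProjection q) (hpN : p ∈ N) (hqN : q ∈ N)
    (hps : p - s ∈ J) (hqs : q - s ∈ J) :
    ((projClass J (interProj (1 - q) p) - projClass J (interProj (1 - p) q) : K0 J) :
      K0Unital (Unitization ℂ J)) =
      hs.relClass hps hp.isIdempotentElem - hs.relClass hqs hq.isIdempotentElem := by
  have hpq : p - q ∈ J := by simpa using J.sub_mem hps hqs
  have hqp : q - p ∈ J := by simpa using J.sub_mem hqs hps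
  have heJ := hJ.interProj_mem hp hq hpN hqN hpq
  have hfJ := hJ.interProj_mem hq hp hqN hpN hqp
  have key {p q : H →L[ℂ] H} (hp : IsStarProjection p) (hps : p - s ∈ J)
      (heJ : interProj (1 - q) p ∈ J) :
      ∃ (h1 : p - interProj (1 - q) p - s ∈ J) (h2 : IsIdempotentElem (p - interProj (1 - q) p)),
        hs.relClass hps hp.isIdempotentElem =
          hs.relClass h1 h2 + (projClass J (interProj (1 - q) p) : K0 J) := by
    have he := isStarProjection_interProj (1 - q) p
    have hpe := mul_interProj_right (p := 1 - q) hp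
    have hep : interProj (1 - q) p * p = interProj (1 - q) p := by
      simpa [hp.isSelfAdjoint.star_eq, he.isSelfAdjoint.star_eq] using congrArg star hpe
    have hee := he.isIdempotentElem.eq
    refine ⟨?_, ?_, ?_⟩
    · rw [sub_right_comm]
      exact J.sub_mem hps heJ
    · rw [IsIdempotentElem, mul_sub, sub_mul, sub_mul, hp.isIdempotentElem.eq, hpe, hep, hee]
      abel
    · rw [projClass, dif_pos ⟨heJ, he.isIdempotentElem⟩]
      refine hs.relClass_eq_add _ _ _ _ _ (sub_add_cancel _ _).symm ?_ ?_
      · rw [sub_mul, hpe, hee, sub_self]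
      · rw [mul_sub, hep, hee, sub_self]
  obtain ⟨h1, h2, h3⟩ := key hp hps heJ
  obtain ⟨h4, h5, h6⟩ := key hq hqs hfJ
  -- With the intersections split off, the two remainders are `v* v` and `v v*`, and both `v*` and
  -- `v` lie in `s + J`.
  suffices hs.relClass h1 h2 = hs.relClass h4 h5 by
    rw [h3, h6, this, AddSubgroupClass.coe_sub]
    abel
  obtain ⟨v, hv1, hv2, hv3, hv4⟩ := hJ.exists_partialIsometry hp hq hpN hqN hpq
  exact hs.relClass_eq_of_equiv h1 h2 h4 h5 (by simpa using J.add_mem hv1 hps)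
    (by simpa using J.add_mem hv2 hps) hv3 hv4

end IsClosedIdeal

/-! ### The operator `χ(F)` modulo an ideal -/

theorem isStarProjection_chi (F : H →L[ℂ] H) : IsStarProjection (chi F) :=
  isStarProjection_kerProj _

theorem chi_mem {N : VonNeumannAlgebra H} {F : H →L[ℂ] H} (hF : F ∈ N) : chi F ∈ N :=
  kerProj_mem (cfc_mem hF _)

theorem chi_mul_negPart (F : H →L[ℂ] H) : chi F * cfc (fun t : ℝ => max (-t) 0) F = 0 := by
  have h := kerProj_star_mul (cfc (fun t : ℝ => max (-t) 0) F)
  rwa [(cfc_predicate (fun t : ℝ => max (-t) 0) F).star_eq] at h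

theorem chi_mul_posPart (F : H →L[ℂ] H) :
    chi F * cfc (fun t : ℝ => max t 0) F = cfc (fun t : ℝ => max t 0) F := by
  refine kerProj_mul_of_mul_eq_zero ?_
  rw [← cfc_mul _ _ F (by fun_prop) (by fun_prop), ← cfc_zero ℝ F]
  congr 1
  ext t
  rcases le_total t 0 with h | h <;> simp [h]

theorem one_sub_cfc {a : H →L[ℂ] H} (ha : IsSelfAdjoint a) {f : ℝ → ℝ} (hf : Continuous f) :
    1 - cfc f a = cfc (fun t => 1 - f t) a := by
  rw [cfc_sub (fun _ => (1 : ℝ)) f a (by fun_prop) (by fun_prop), cfc_const_one ℝ a]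

theorem continuous_one_add_abs_inv : Continuous fun t : ℝ => (1 + |t|)⁻¹ :=
  Continuous.inv₀ (by fun_prop) fun t => by positivity

/-- For `t ≥ 0` the first term is already `1`; for `t ≤ 0` it is `(1 + t) / (1 - t)` and the second
adds `-2t / (1 - t)`. The second term carries the negative part of `F`, which `χ(F)` annihilates. -/
theorem one_eq_cfc_mul_one_add {F : H →L[ℂ] H} (hF : IsSelfAdjoint F) :
    1 = cfc (fun t : ℝ => (1 + |t|)⁻¹) F * (1 + F) +
      cfc (fun t : ℝ => max (-t) 0) F * cfc (fun t : ℝ => 2 * (1 + |t|)⁻¹) F := by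
  have hc := continuous_one_add_abs_inv
  have h1 : 1 + F = cfc (fun t : ℝ => 1 + t) F := by
    rw [cfc_const_add 1 (fun t : ℝ => t) F, cfc_id' ℝ F, map_one]
  have hc2 : Continuous fun t : ℝ => 2 * (1 + |t|)⁻¹ := continuous_const.mul hc
  rw [h1, ← cfc_mul _ _ F hc.continuousOn (by fun_prop),
    ← cfc_mul _ _ F (by fun_prop) hc2.continuousOn,
    ← cfc_add F (fun t : ℝ => (1 + |t|)⁻¹ * (1 + t)) (fun t : ℝ => max (-t) 0 * (2 * (1 + |t|)⁻¹))
      (hc.mul (by fun_prop)).continuousOn (Continuous.mul (by fun_prop) hc2).continuousOn,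
    ← cfc_one ℝ F]
  congr 1
  ext t
  change 1 = (1 + |t|)⁻¹ * (1 + t) + max (-t) 0 * (2 * (1 + |t|)⁻¹)
  have h : (1 + |t|) ≠ 0 := by positivity
  rcases le_total t 0 with h0 | h0
  · rw [abs_of_nonpos h0] at h ⊢
    rw [max_eq_left (by linarith)]
    field_simp
    ring
  · rw [abs_of_nonneg h0] at h ⊢
    rw [max_eq_right (by linarith)]
    field_simp
    ring

/-- The mirror image under `t ↦ -t`; here `1 - χ(F)` annihilates the second term. -/
theorem one_eq_cfc_mul_one_sub {F : H →L[ℂ] H} (hF : IsSelfAdjoint F) :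
    1 = cfc (fun t : ℝ => (1 + |t|)⁻¹) F * (1 - F) +
      cfc (fun t : ℝ => max t 0) F * cfc (fun t : ℝ => 2 * (1 + |t|)⁻¹) F := by
  have hc := continuous_one_add_abs_inv
  have h1 : 1 - F = cfc (fun t : ℝ => 1 - t) F := by
    conv_lhs => rw [← cfc_id' ℝ F]
    exact one_sub_cfc hF continuous_id
  have hc2 : Continuous fun t : ℝ => 2 * (1 + |t|)⁻¹ := continuous_const.mul hc
  rw [h1, ← cfc_mul _ _ F hc.continuousOn (by fun_prop),
    ← cfc_mul _ _ F (by fun_prop) hc2.continuousOn,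
    ← cfc_add F (fun t : ℝ => (1 + |t|)⁻¹ * (1 - t)) (fun t : ℝ => max t 0 * (2 * (1 + |t|)⁻¹))
      (hc.mul (by fun_prop)).continuousOn (Continuous.mul (by fun_prop) hc2).continuousOn,
    ← cfc_one ℝ F]
  congr 1
  ext t
  change 1 = (1 + |t|)⁻¹ * (1 - t) + max t 0 * (2 * (1 + |t|)⁻¹)
  have h : (1 + |t|) ≠ 0 := by positivity
  rcases le_total t 0 with h0 | h0
  · rw [abs_of_nonpos h0] at h ⊢
    rw [max_eq_right (by linarith)]
    field_simp
    ring
  · rw [abs_of_nonneg h0] at h ⊢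
    rw [max_eq_left (by linarith)]
    field_simp
    ring

/-- If `F² = 1` modulo `J`, then `χ(F) = (1 + F) / 2` modulo `J`. -/
theorem IsClosedIdeal.two_chi_sub_mem {N : VonNeumannAlgebra H}
    {J : NonUnitalSubalgebra ℂ (H →L[ℂ] H)} (hJ : IsClosedIdeal N J) {F : H →L[ℂ] H}
    (hF : IsSelfAdjoint F) (hFN : F ∈ N) (h : 1 - F * F ∈ J) : 2 • chi F - (1 + F) ∈ J := by
  set g := cfc (fun t : ℝ => (1 + |t|)⁻¹) F
  set k := cfc (fun t : ℝ => 2 * (1 + |t|)⁻¹) F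
  have hg : g ∈ N := cfc_mem hFN _
  have hE := chi_mem hFN
  have e1 : (1 + F) * (1 - F) = 1 - F * F := by noncomm_ring
  have e2 : (1 - F) * (1 + F) = 1 - F * F := by noncomm_ring
  have h1 : chi F * (1 - F) = chi F * g * (1 - F * F) := by
    calc chi F * (1 - F) = chi F * (g * (1 + F) +
          cfc (fun t : ℝ => max (-t) 0) F * k) * (1 - F) := by
          rw [← one_eq_cfc_mul_one_add hF, mul_one]
      _ = chi F * g * ((1 + F) * (1 - F)) +
          chi F * cfc (fun t : ℝ => max (-t) 0) F * (k * (1 - F)) := by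
          generalize 1 - F = u
          generalize 1 + F = w
          simp only [mul_add, add_mul, mul_assoc]
      _ = _ := by rw [chi_mul_negPart, zero_mul, add_zero, e1]
  have h2 : (1 - chi F) * (1 + F) = (1 - chi F) * g * (1 - F * F) := by
    calc (1 - chi F) * (1 + F) = (1 - chi F) * (g * (1 - F) +
          cfc (fun t : ℝ => max t 0) F * k) * (1 + F) := by
          rw [← one_eq_cfc_mul_one_sub hF, mul_one]
      _ = (1 - chi F) * g * ((1 - F) * (1 + F)) +
          (1 - chi F) * cfc (fun t : ℝ => max t 0) F * (k * (1 + F)) := by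
          generalize 1 - chi F = e
          generalize 1 - F = u
          generalize 1 + F = w
          simp only [mul_add, add_mul, mul_assoc]
      _ = _ := by
          rw [sub_mul 1 (chi F) (cfc (fun t : ℝ => max t 0) F), one_mul, chi_mul_posPart, sub_self,
            zero_mul, add_zero, e2]
  have h3 : 2 • chi F - (1 + F) = chi F * (1 - F) - (1 - chi F) * (1 + F) := by noncomm_ring
  rw [h3, h1, h2]
  exact J.sub_mem (hJ.mul_mem_left _ (mul_mem hE hg) _ h)
    (hJ.mul_mem_left _ (mul_mem (sub_mem (one_mem N) hE) hg) _ h)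

/-- Modulo `J` the discontinuous function `χ` may be replaced by the affine function `(1 + t) / 2`.
-/
theorem IsClosedIdeal.chi_sub_chi_mem {N : VonNeumannAlgebra H}
    {J : NonUnitalSubalgebra ℂ (H →L[ℂ] H)} (hJ : IsClosedIdeal N J) {F G : H →L[ℂ] H}
    (hF : IsSelfAdjoint F) (hFN : F ∈ N) (hFJ : 1 - F * F ∈ J)
    (hG : IsSelfAdjoint G) (hGN : G ∈ N) (hGJ : 1 - G * G ∈ J) (h : F - G ∈ J) :
    chi F - chi G ∈ J := by
  have h1 := J.add_mem (J.sub_mem (hJ.two_chi_sub_mem hF hFN hFJ)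
    (hJ.two_chi_sub_mem hG hGN hGJ)) h
  have h2 := J.toSubmodule.smul_mem (1 / 2 : ℂ) h1
  have e : chi F - chi G =
      (1 / 2 : ℂ) • (2 • chi F - (1 + F) - (2 • chi G - (1 + G)) + (F - G)) := by module
  rw [e]
  exact h2

/-! ### A Sylvester equation -/

/-- An infinitesimal form of the solution formula `Y = ∫ e^(-tP) C e^(-tQ) dt`: expand `(1 - hP) Y
(1 - hQ) = Y - hC + h² P Y Q`, take norms, divide by `h` and let `h → 0`. -/
theorem two_mul_norm_le_of_sylvester {B : Type*} [NormedRing B] [NormedAlgebra ℝ B]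
    {P Q Y C : B} {m h₀ : ℝ} (h₀pos : 0 < h₀)
    (hP : ∀ h, 0 ≤ h → h ≤ h₀ → ‖1 - h • P‖ ≤ 1 - h * m)
    (hQ : ∀ h, 0 ≤ h → h ≤ h₀ → ‖1 - h • Q‖ ≤ 1 - h * m) (hY : P * Y + Y * Q = C) :
    2 * m * ‖Y‖ ≤ ‖C‖ := by
  have key : ∀ h, 0 < h → h ≤ h₀ → (2 * m - h * m ^ 2) * ‖Y‖ ≤ ‖C‖ + h * ‖P * Y * Q‖ := by
    intro h hpos hle
    have e : Y = (1 - h • P) * Y * (1 - h • Q) + h • C - (h * h) • (P * Y * Q) := by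
      rw [← hY]
      simp only [sub_mul, mul_sub, one_mul, mul_one, smul_mul_assoc, mul_smul_comm, smul_add,
        smul_sub, smul_smul]
      abel
    have h1 : ‖(1 - h • P) * Y * (1 - h • Q)‖ ≤ (1 - h * m) * ‖Y‖ * (1 - h * m) := by
      refine (norm_mul_le _ _).trans ?_
      have h2 := hP h hpos.le hle
      have h3 := hQ h hpos.le hle
      have h4 : 0 ≤ 1 - h * m := (norm_nonneg _).trans h2
      refine mul_le_mul ((norm_mul_le _ _).trans ?_) h3 (norm_nonneg _) (by positivity)
      gcongr
    have h5 : ‖Y‖ ≤ (1 - h * m) * ‖Y‖ * (1 - h * m) + h * ‖C‖ + h * h * ‖P * Y * Q‖ := by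
      conv_lhs => rw [e]
      refine (norm_sub_le _ _).trans (add_le_add ((norm_add_le _ _).trans (add_le_add h1 ?_)) ?_)
      · rw [norm_smul, Real.norm_of_nonneg hpos.le]
      · rw [norm_smul, Real.norm_of_nonneg (by positivity)]
    refine le_of_mul_le_mul_left ?_ hpos
    nlinarith
  have l1 : Filter.Tendsto (fun h : ℝ => (2 * m - h * m ^ 2) * ‖Y‖) (nhdsWithin 0 (Set.Ioi 0))
      (nhds (2 * m * ‖Y‖)) := by
    have : Continuous fun h : ℝ => (2 * m - h * m ^ 2) * ‖Y‖ := by fun_prop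
    simpa using (this.tendsto 0).mono_left nhdsWithin_le_nhds
  have l2 : Filter.Tendsto (fun h : ℝ => ‖C‖ + h * ‖P * Y * Q‖) (nhdsWithin 0 (Set.Ioi 0))
      (nhds ‖C‖) := by
    have : Continuous fun h : ℝ => ‖C‖ + h * ‖P * Y * Q‖ := by fun_prop
    simpa using (this.tendsto 0).mono_left nhdsWithin_le_nhds
  refine le_of_tendsto_of_tendsto l1 l2 ?_
  filter_upwards [Ioc_mem_nhdsGT h₀pos] with h hh
  exact key h hh.1 hh.2

/-- The restriction `h ≤ 1 / M` keeps `1 - h f` nonnegative, so that its norm is governed by the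
lower bound `m` of `f`. -/
theorem norm_one_sub_smul_cfc_le {a : H →L[ℂ] H} (ha : IsSelfAdjoint a) {f : ℝ → ℝ}
    (hf : Continuous f) {m M : ℝ} (hM : 0 < M) (hfm : ∀ t, m ≤ f t) (hfM : ∀ t, f t ≤ M) (h : ℝ)
    (h0 : 0 ≤ h) (h1 : h ≤ M⁻¹) : ‖1 - h • cfc f a‖ ≤ 1 - h * m := by
  have hM1 : h * M ≤ 1 := by
    rw [← inv_mul_cancel₀ hM.ne']; gcongr
  have e : 1 - h • cfc f a = cfc (fun t => 1 - h * f t) a := by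
    rw [← cfc_const_mul h f a]
    exact one_sub_cfc ha (by fun_prop)
  have h3 := fun t => mul_le_mul_of_nonneg_left (hfM t) h0
  have h4 := fun t => mul_le_mul_of_nonneg_left (hfm t) h0
  rw [e]
  refine norm_cfc_le (by linarith [h3 0, h4 0]) fun t _ => ?_
  rw [Real.norm_of_nonneg (by linarith [h3 t])]
  linarith [h4 t]

/-- On the support of the cutoff both `a` and `b` are invertible. Dividing by `a` on the left and
`b` on the right turns the equation into `a⁻¹ Y + Y b⁻¹ = φ(a) C φ(b)` for `Y = φ(a) X φ(b)`, with
inverses at least `1 / δ`. -/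
theorem norm_cutoff_le {a b X C : H →L[ℂ] H} (ha : IsSelfAdjoint a) (hb : IsSelfAdjoint b)
    (h : a * X + X * b = a * C * b) {φ : ℝ → ℝ} (hφ : Continuous φ) (hφ1 : ∀ t, |φ t| ≤ 1)
    {ε δ : ℝ} (hε : 0 < ε) (hεδ : ε ≤ δ)
    (hφa : ∀ t ∈ spectrum ℝ a, φ t ≠ 0 → ε ≤ t ∧ t ≤ δ)
    (hφb : ∀ t ∈ spectrum ℝ b, φ t ≠ 0 → ε ≤ t ∧ t ≤ δ) :
    ‖cfc φ a * X * cfc φ b‖ ≤ δ / 2 * ‖C‖ := by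
  have hδ : 0 < δ := hε.trans_le hεδ
  -- Clamping to `[ε, δ]` makes `1 / t` continuous with values between `1 / δ` and `1 / ε`, without
  -- changing it where it is used.
  set f : ℝ → ℝ := fun t => (max ε (min t δ))⁻¹ with hf
  have hpos : ∀ t, 0 < max ε (min t δ) := fun t => lt_max_of_lt_left hε
  have hfc : Continuous f := Continuous.inv₀ (by fun_prop) fun t => (hpos t).ne'
  have hfm : ∀ t, δ⁻¹ ≤ f t := fun t => by
    refine inv_anti₀ (hpos t) (max_le hεδ (min_le_right _ _))
  have hfM : ∀ t, f t ≤ ε⁻¹ := fun t => inv_anti₀ hε (le_max_left _ _)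
  have key {c : H →L[ℂ] H} (hc : IsSelfAdjoint c)
      (hφc : ∀ t ∈ spectrum ℝ c, φ t ≠ 0 → ε ≤ t ∧ t ≤ δ) :
      cfc f c * c * cfc φ c = cfc φ c := by
    have hm : cfc f c * c = cfc (fun t => f t * t) c := by
      rw [cfc_mul f (fun t => t) c (by fun_prop) (by fun_prop), cfc_id' ℝ c]
    rw [hm, ← cfc_mul _ _ c (by fun_prop) (by fun_prop)]
    refine cfc_congr fun t ht => ?_
    rcases eq_or_ne (φ t) 0 with h0 | h0
    · simp [h0]
    · obtain ⟨h1, h2⟩ := hφc t ht h0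
      have : f t = t⁻¹ := by simp only [hf]; rw [min_eq_left h2, max_eq_right h1]
      simp only [this]
      rw [inv_mul_cancel₀ (hε.trans_le h1).ne', one_mul]
  have comm (c : H →L[ℂ] H) : cfc f c * cfc φ c = cfc φ c * cfc f c := (cfc_commute_cfc f φ c).eq
  have comm' {c : H →L[ℂ] H} (hc : IsSelfAdjoint c) (k : ℝ → ℝ) : c * cfc k c = cfc k c * c := by
    exact ((Commute.refl c).cfc_real k).symm.eq
  have e1 : cfc φ a = cfc f a * cfc φ a * a := by
    conv_lhs => rw [← key ha hφa]
    rw [mul_assoc, comm' ha, mul_assoc]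
  have e2 : cfc φ b = b * cfc φ b * cfc f b := by
    conv_lhs => rw [← key hb hφb]
    rw [← comm' hb, mul_assoc, comm, mul_assoc]
  have heq : cfc f a * (cfc φ a * X * cfc φ b) + cfc φ a * X * cfc φ b * cfc f b =
      cfc φ a * C * cfc φ b := by
    calc _ = cfc f a * cfc φ a * (X * b) * (cfc φ b * cfc f b) +
        cfc f a * cfc φ a * (a * X) * (cfc φ b * cfc f b) := by
          congr 1
          · conv_lhs => rw [e2]
            simp only [mul_assoc]
          · conv_lhs => rw [e1]
            simp only [mul_assoc]
      _ = cfc f a * cfc φ a * (a * C * b) * (cfc φ b * cfc f b) := by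
          rw [← add_mul, ← mul_add, add_comm, h]
      _ = (cfc f a * cfc φ a * a) * C * (b * cfc φ b * cfc f b) := by simp only [mul_assoc]
      _ = _ := by rw [← e1, ← e2]
  have h1 := two_mul_norm_le_of_sylvester (m := δ⁻¹) (h₀ := (ε⁻¹)⁻¹) (by positivity)
    (norm_one_sub_smul_cfc_le ha hfc (by positivity) hfm hfM)
    (norm_one_sub_smul_cfc_le hb hfc (by positivity) hfm hfM) heq
  have hn (c : H →L[ℂ] H) : ‖cfc φ c‖ ≤ 1 := norm_cfc_le zero_le_one fun t _ => hφ1 t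
  have h2 : ‖cfc φ a * C * cfc φ b‖ ≤ ‖C‖ := by
    refine (norm_mul_le _ _).trans ((mul_le_mul (norm_mul_le _ _) (hn b) (norm_nonneg _)
      (by positivity)).trans ?_)
    rw [mul_one]
    exact mul_le_of_le_one_left (norm_nonneg _) (hn a)
  have h3 := h1.trans h2
  rw [mul_assoc, ← div_eq_inv_mul, mul_div_assoc', div_le_iff₀ hδ] at h3
  linarith

/-- The continuous cutoff functions `min (1, max (n t - 1, 0))`. -/
def lowCutoff (n : ℕ) (t : ℝ) : ℝ := max 0 (min 1 (n * t - 1))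

theorem continuous_lowCutoff (n : ℕ) : Continuous (lowCutoff n) := by
  unfold lowCutoff; fun_prop

theorem lowCutoff_nonneg (n : ℕ) (t : ℝ) : 0 ≤ lowCutoff n t := le_max_left _ _

theorem lowCutoff_le_one (n : ℕ) (t : ℝ) : lowCutoff n t ≤ 1 :=
  max_le zero_le_one (min_le_left _ _)

theorem abs_lowCutoff_le (n : ℕ) (t : ℝ) : |lowCutoff n t| ≤ 1 := by
  rw [abs_of_nonneg (lowCutoff_nonneg n t)]; exact lowCutoff_le_one n t

theorem le_of_lowCutoff_ne_zero {n : ℕ} {t : ℝ} (hn : 0 < n) (h : lowCutoff n t ≠ 0) :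
    (n : ℝ)⁻¹ ≤ t := by
  by_contra! h1
  refine h (max_eq_left ((min_le_right _ _).trans ?_))
  have hn' : (0 : ℝ) < n := by exact_mod_cast hn
  have := mul_lt_mul_of_pos_left h1 hn'
  rw [mul_inv_cancel₀ hn'.ne'] at this
  linarith

theorem abs_lowCutoff_mul_sub_le {n : ℕ} (hn : 0 < n) {t : ℝ} (ht : 0 ≤ t) :
    |lowCutoff n t * t - t| ≤ 2 / n := by
  have hn' : (0 : ℝ) < n := by exact_mod_cast hn
  rcases le_total 2 (n * t) with h | h
  · have : lowCutoff n t = 1 := by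
      rw [lowCutoff, min_eq_left (by linarith), max_eq_right zero_le_one]
    rw [this, one_mul, sub_self, abs_zero]
    positivity
  · have h1 := lowCutoff_nonneg n t
    have h2 := lowCutoff_le_one n t
    have h3 : t ≤ 2 / n := by rw [le_div_iff₀ hn']; linarith
    rw [abs_le]
    constructor <;> nlinarith

theorem norm_cfc_lowCutoff_le (n : ℕ) (a : H →L[ℂ] H) : ‖cfc (lowCutoff n) a‖ ≤ 1 :=
  norm_cfc_le zero_le_one fun t _ => abs_lowCutoff_le n t

/-- The cutoffs times `a` tend to `a` in norm, which settles vectors in the range of `a`; density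
and the uniform bound `1` do the rest. -/
theorem tendsto_lowCutoff {a : H →L[ℂ] H} (ha : 0 ≤ a) (hd : DenseRange a) (x : H) :
    Filter.Tendsto (fun n : ℕ => cfc (lowCutoff n) a x) Filter.atTop (nhds x) := by
  have hsa : IsSelfAdjoint a := ha.isSelfAdjoint
  have hna (n : ℕ) (h : 0 < n) : ‖cfc (lowCutoff n) a * a - a‖ ≤ 2 / n := by
    have hc := continuous_lowCutoff n
    have e : cfc (lowCutoff n) a * a - a = cfc (fun t => lowCutoff n t * t - t) a := by
      rw [cfc_sub (fun t => lowCutoff n t * t) (fun t => t) a (by fun_prop) (by fun_prop),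
        cfc_mul (lowCutoff n) (fun t => t) a (by fun_prop) (by fun_prop), cfc_id' ℝ a]
    rw [e]
    exact norm_cfc_le (by positivity) fun t ht =>
      abs_lowCutoff_mul_sub_le h (spectrum_nonneg_of_nonneg ha ht)
  rw [Metric.tendsto_atTop]
  intro ε hε
  obtain ⟨w, hw⟩ := hd.exists_dist_lt x (show 0 < ε / 4 by positivity)
  obtain ⟨m, hm⟩ := exists_nat_gt (2 * ‖w‖ / (ε / 4))
  refine ⟨m + 1, fun n hmn => ?_⟩
  have hn0 : 0 < n := by omega
  have hn' : (0 : ℝ) < n := by exact_mod_cast hn0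
  have hmn' : (m : ℝ) ≤ n := by exact_mod_cast (by omega : m ≤ n)
  have e : cfc (lowCutoff n) a x - x =
      cfc (lowCutoff n) a (x - a w) + (cfc (lowCutoff n) a * a - a) w - (x - a w) := by
    simp
  rw [dist_eq_norm] at hw ⊢
  rw [e]
  have h1 : ‖cfc (lowCutoff n) a (x - a w)‖ ≤ 1 * ‖x - a w‖ :=
    ContinuousLinearMap.le_of_opNorm_le _ (norm_cfc_lowCutoff_le n a) _
  have h2 : ‖(cfc (lowCutoff n) a * a - a) w‖ ≤ 2 / n * ‖w‖ :=
    ContinuousLinearMap.le_of_opNorm_le _ (hna n hn0) _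
  have h3 : 2 / n * ‖w‖ ≤ ε / 4 := by
    rw [div_mul_eq_mul_div, div_le_iff₀ hn']
    rw [div_lt_iff₀ (by positivity)] at hm
    nlinarith
  have h4 := norm_sub_le (cfc (lowCutoff n) a (x - a w) + (cfc (lowCutoff n) a * a - a) w) (x - a w)
  have h5 := norm_add_le (cfc (lowCutoff n) a (x - a w)) ((cfc (lowCutoff n) a * a - a) w)
  linarith

/-- The compressed operators converge strongly to `Y`, and a norm bound survives strong limits. -/
theorem norm_le_of_lowCutoff_mul_mul {a b Y : H →L[ℂ] H} (ha : 0 ≤ a) (hb : 0 ≤ b)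
    (hda : DenseRange a) (hdb : DenseRange b) {M : ℝ} (hM : 0 ≤ M)
    (h : ∀ᶠ n : ℕ in Filter.atTop, ‖cfc (lowCutoff n) a * Y * cfc (lowCutoff n) b‖ ≤ M) :
    ‖Y‖ ≤ M := by
  refine ContinuousLinearMap.opNorm_le_bound _ hM fun x => ?_
  have h1 := (Y.continuous.tendsto x).comp (tendsto_lowCutoff hb hdb x)
  have h2 : Filter.Tendsto (fun n : ℕ => (cfc (lowCutoff n) a * Y * cfc (lowCutoff n) b) x)
      Filter.atTop (nhds (Y x)) := by
    have h3 : Filter.Tendsto (fun n : ℕ => cfc (lowCutoff n) a (Y (cfc (lowCutoff n) b x) - Y x))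
        Filter.atTop (nhds 0) := by
      refine squeeze_zero_norm (fun n => ?_) (tendsto_iff_norm_sub_tendsto_zero.1 h1)
      simpa using ContinuousLinearMap.le_of_opNorm_le _ (norm_cfc_lowCutoff_le n a)
        (Y (cfc (lowCutoff n) b x) - Y x)
    simpa using h3.add (tendsto_lowCutoff ha hda (Y x))
  refine le_of_tendsto h2.norm ?_
  filter_upwards [h] with n hn
  exact ContinuousLinearMap.le_of_opNorm_le _ hn x

/-- If `a X + X b = a C b`, the part of `X` that lives on the spectral subspaces of `a` and `b`
for `[0, δ]` has norm at most `δ ‖C‖ / 2`. -/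
theorem norm_cutoff_le_of_sylvester {a b X C : H →L[ℂ] H} (ha : 0 ≤ a) (hb : 0 ≤ b)
    (hda : DenseRange a) (hdb : DenseRange b) (h : a * X + X * b = a * C * b)
    {g : ℝ → ℝ} (hg : Continuous g) (hg1 : ∀ t, |g t| ≤ 1) {δ : ℝ} (hδ : 0 < δ)
    (hga : ∀ t ∈ spectrum ℝ a, g t ≠ 0 → t ≤ δ) (hgb : ∀ t ∈ spectrum ℝ b, g t ≠ 0 → t ≤ δ) :
    ‖cfc g a * X * cfc g b‖ ≤ δ / 2 * ‖C‖ := by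
  have hsa : IsSelfAdjoint a := ha.isSelfAdjoint
  have hsb : IsSelfAdjoint b := hb.isSelfAdjoint
  have hl := continuous_lowCutoff
  refine norm_le_of_lowCutoff_mul_mul ha hb hda hdb (by positivity) ?_
  obtain ⟨k, hk⟩ := exists_nat_gt δ⁻¹
  filter_upwards [Filter.eventually_ge_atTop k] with n hn
  have hkn : δ⁻¹ < n := hk.trans_le (by exact_mod_cast hn)
  have hn' : (0 : ℝ) < n := (inv_pos.2 hδ).trans hkn
  have hn0 : 0 < n := by exact_mod_cast hn'
  -- The extra factor supplies the lower bound `ε = 1 / n`; the resulting estimate is independent of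
  -- `n`.
  have key := norm_cutoff_le hsa hsb h (φ := fun t => lowCutoff n t * g t)
    ((hl n).mul hg) (fun t => by
      rw [abs_mul]; exact mul_le_one₀ (abs_lowCutoff_le n t) (abs_nonneg _) (hg1 t))
    (inv_pos.2 hn') (inv_le_of_inv_le₀ hδ hkn.le)
    (fun t ht h0 => ⟨le_of_lowCutoff_ne_zero hn0 (left_ne_zero_of_mul h0),
      hga t ht (right_ne_zero_of_mul h0)⟩)
    (fun t ht h0 => ⟨le_of_lowCutoff_ne_zero hn0 (left_ne_zero_of_mul h0),
      hgb t ht (right_ne_zero_of_mul h0)⟩)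
  have e1 : cfc (fun t => lowCutoff n t * g t) a = cfc (lowCutoff n) a * cfc g a :=
    cfc_mul _ _ a (hl n).continuousOn hg.continuousOn
  have e2 : cfc (fun t => lowCutoff n t * g t) b = cfc g b * cfc (lowCutoff n) b := by
    rw [(cfc_commute_cfc g (lowCutoff n) b).eq]
    exact cfc_mul _ _ b (hl n).continuousOn hg.continuousOn
  rw [e1, e2] at key
  simpa only [mul_assoc] using key

theorem norm_le_of_sylvester {a b X C : H →L[ℂ] H} (ha : 0 ≤ a) (hb : 0 ≤ b)
    (hda : DenseRange a) (hdb : DenseRange b) (h : a * X + X * b = a * C * b)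
    (ha1 : ‖a‖ ≤ 1) (hb1 : ‖b‖ ≤ 1) : ‖X‖ ≤ ‖C‖ / 2 := by
  have hsa : IsSelfAdjoint a := ha.isSelfAdjoint
  have hsb : IsSelfAdjoint b := hb.isSelfAdjoint
  have hs {c : H →L[ℂ] H} (hc : ‖c‖ ≤ 1) (t : ℝ) (ht : t ∈ spectrum ℝ c) : t ≤ 1 := by
    refine (le_abs_self t).trans ((spectrum.norm_le_norm_mul_of_mem ht).trans ?_)
    refine (mul_le_of_le_one_right (norm_nonneg _) ContinuousLinearMap.norm_id_le).trans hc
  have := norm_cutoff_le_of_sylvester ha hb hda hdb h (g := fun _ => 1) (by fun_prop) (by simp)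
    one_pos (fun t ht _ => hs ha1 t ht) (fun t ht _ => hs hb1 t ht)
  rw [cfc_const_one ℝ a, cfc_const_one ℝ b, one_mul, mul_one] at this
  linarith

/-- Modulo `J` the operator `X` equals its compression `g(a) X g(b)` near the bottom of the spectra,
whose norm is at most `δ ‖C‖ / 2` for arbitrarily small `δ`. So `X` has distance `0` from the closed
set `J`. -/
theorem IsClosedIdeal.mem_of_sylvester {N : VonNeumannAlgebra H}
    {J : NonUnitalSubalgebra ℂ (H →L[ℂ] H)} (hJ : IsClosedIdeal N J) {a b X C : H →L[ℂ] H}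
    (ha : 0 ≤ a) (hb : 0 ≤ b) (haN : a ∈ N) (hbN : b ∈ N) (hXN : X ∈ N)
    (haJ : a * a ∈ J) (hbJ : b * b ∈ J)
    (hda : DenseRange a) (hdb : DenseRange b) (h : a * X + X * b = a * C * b) : X ∈ J := by
  have hne : (J : Set (H →L[ℂ] H)).Nonempty := ⟨0, J.zero_mem⟩
  refine SetLike.mem_coe.1 ((hJ.isClosed.mem_iff_infDist_zero hne).2 ?_)
  refine le_antisymm (le_of_forall_pos_le_add fun ε hε => ?_) Metric.infDist_nonneg
  set δ : ℝ := ε / (‖C‖ + 1) with hδdef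
  have hδ : 0 < δ := by positivity
  -- This is `1 / t²` truncated near `0`, so that `1 - g(c) = c² k(c)` is a multiple of `c² ∈ J`
  -- while `g` vanishes beyond `δ`.
  set k : ℝ → ℝ := fun t => (max (t * t) (δ * δ))⁻¹ with hk
  have hmax : ∀ t : ℝ, 0 < max (t * t) (δ * δ) := fun t => lt_max_of_lt_right (by positivity)
  have hkc : Continuous k := Continuous.inv₀ (by fun_prop) fun t => (hmax t).ne'
  set g : ℝ → ℝ := fun t => 1 - t * t * k t with hg
  have hgc : Continuous g := by fun_prop
  have htk : ∀ t, 0 ≤ t * t * k t ∧ t * t * k t ≤ 1 := fun t => by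
    refine ⟨mul_nonneg (mul_self_nonneg t) (inv_pos.2 (hmax t)).le, ?_⟩
    simp only [hk]
    rw [← div_eq_mul_inv, div_le_one (hmax t)]
    exact le_max_left _ _
  have hg1 : ∀ t, |g t| ≤ 1 := fun t => by
    rw [abs_le]; constructor <;> simp only [hg] <;> linarith [(htk t).1, (htk t).2]
  have hgδ : ∀ t, g t ≠ 0 → t ≤ δ := fun t ht => by
    by_contra! hlt
    have : δ * δ ≤ t * t := mul_self_le_mul_self hδ.le hlt.le
    refine ht ?_
    simp only [hg, hk]
    rw [max_eq_left this, mul_inv_cancel₀ (by nlinarith), sub_self]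
  have hcut {c : H →L[ℂ] H} (hc : 0 ≤ c) (hcN : c ∈ N) (hcJ : c * c ∈ J) : 1 - cfc g c ∈ J := by
    have hcs : IsSelfAdjoint c := hc.isSelfAdjoint
    have : 1 - cfc g c = c * c * cfc k c := by
      rw [one_sub_cfc hcs hgc]
      conv_rhs => enter [1]; rw [← cfc_id' ℝ c]
      rw [← cfc_mul _ _ c (by fun_prop) (by fun_prop), ← cfc_mul _ _ c (by fun_prop) (by fun_prop)]
      simp only [hg, sub_sub_cancel]
    rw [this]
    exact hJ.mul_mem_right _ (cfc_mem hcN k) _ hcJ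
  have hmem : X - cfc g a * X * cfc g b ∈ J := by
    have : X - cfc g a * X * cfc g b =
        (1 - cfc g a) * X + cfc g a * X * (1 - cfc g b) := by
      rw [sub_mul, mul_sub, one_mul, mul_one]; abel
    rw [this]
    exact J.add_mem (hJ.mul_mem_right _ hXN _ (hcut ha haN haJ))
      (hJ.mul_mem_left _ (mul_mem (cfc_mem haN g) hXN) _ (hcut hb hbN hbJ))
  refine (Metric.infDist_le_dist_of_mem hmem).trans ?_
  rw [dist_eq_norm, sub_sub_cancel, zero_add]
  refine (norm_cutoff_le_of_sylvester ha hb hda hdb h hgc hg1 hδ (fun t _ => hgδ t)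
    (fun t _ => hgδ t)).trans ?_
  rw [hδdef, div_div, div_mul_eq_mul_div, div_le_iff₀ (by positivity)]
  nlinarith [norm_nonneg C]

/-! ### Self-adjoint operators and their resolvents -/

section SelfAdjoint

variable {D : H →ₗ.[ℂ] H}

theorem inner_apply_comm (hD : IsSelfAdjoint D) (x y : D.domain) :
    inner ℂ (D x) (y : H) = inner ℂ (x : H) (D y) := by
  have h := LinearPMap.adjoint_isFormalAdjoint hD.dense_domain
  rw [LinearPMap.isSelfAdjoint_def.1 hD] at h
  exact h x y

/-- This is the inclusion of the adjoint in `D`: it produces domain membership out of inner products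
alone. -/
theorem exists_mem_domain_of_inner (hD : IsSelfAdjoint D) {y w : H}
    (h : ∀ x : D.domain, inner ℂ w (x : H) = inner ℂ y (D x)) :
    ∃ hy : y ∈ D.domain, D ⟨y, hy⟩ = w := by
  have hmem := LinearPMap.mem_adjoint_domain_of_exists (T := D) y ⟨w, h⟩
  have happ := LinearPMap.adjoint_apply_eq hD.dense_domain ⟨y, hmem⟩ h
  have hle : D.adjoint ≤ D := (LinearPMap.isSelfAdjoint_def.1 hD).le
  exact ⟨hle.1 hmem, by rw [← happ]; exact (hle.2 rfl).symm⟩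

theorem isSelfAdjoint_of_inner (hd : Dense (D.domain : Set H))
    (h₁ : ∀ x y : D.domain, inner ℂ (D x) (y : H) = inner ℂ (x : H) (D y))
    (h₂ : ∀ y w : H, (∀ x : D.domain, inner ℂ w (x : H) = inner ℂ y (D x)) → y ∈ D.domain) :
    IsSelfAdjoint D := by
  rw [LinearPMap.isSelfAdjoint_def]
  have hle : D.adjoint ≤ D ↔ _ := Iff.rfl
  refine le_antisymm (hle.2 ⟨fun y hy => ?_, fun x y hxy => ?_⟩)
    (LinearPMap.IsFormalAdjoint.le_adjoint hd h₁)
  · exact h₂ y (D.adjoint ⟨y, hy⟩) fun x => LinearPMap.adjoint_isFormalAdjoint hd ⟨y, hy⟩ x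
  · exact LinearPMap.adjoint_apply_eq hd x fun z => by rw [h₁, hxy]

/-- As `⟨x, D x⟩` is real, the imaginary part of `⟨x, z x - D x⟩` is `Im z ‖x‖²`; then
Cauchy-Schwarz applies. -/
theorem abs_im_mul_norm_le (hD : IsSelfAdjoint D) (z : ℂ) (x : D.domain) :
    |z.im| * ‖(x : H)‖ ≤ ‖z • (x : H) - D x‖ := by
  have hreal : (inner ℂ (x : H) (D x)).im = 0 := by
    have h := inner_apply_comm hD x x
    rw [← inner_conj_symm] at h
    have := congrArg Complex.im h
    rw [Complex.conj_im] at this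
    linarith
  have h1 : (inner ℂ (x : H) (z • (x : H) - D x)).im = z.im * ‖(x : H)‖ ^ 2 := by
    rw [inner_sub_right, inner_smul_right, Complex.sub_im, hreal, inner_self_eq_norm_sq_to_K,
      sub_zero]
    simp [← Complex.ofReal_pow]
  have h2 : |z.im| * ‖(x : H)‖ ^ 2 ≤ ‖(x : H)‖ * ‖z • (x : H) - D x‖ := by
    rw [← abs_of_nonneg (sq_nonneg ‖(x : H)‖), ← abs_mul, ← h1]
    exact (Complex.abs_im_le_norm _).trans (norm_inner_le_norm _ _)
  rcases eq_or_lt_of_le (norm_nonneg (x : H)) with h0 | h0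
  · rw [← h0, mul_zero]; exact norm_nonneg _
  · refine le_of_mul_le_mul_left ?_ h0
    linarith

/-- On the closed graph of `D`, a Hilbert space, `z - D` is a bounded map that is bounded below, so
its range is closed. A vector orthogonal to the range would be an eigenvector of `D` for the
non-real value `conj z`, hence is zero. -/
theorem exists_isBoundedInverse (hD : IsSelfAdjoint D) {z : ℂ} (hz : z.im ≠ 0) :
    ∃ R : H →L[ℂ] H, (∀ y, ∃ h : R y ∈ D.domain, D ⟨R y, h⟩ = z • R y - y) ∧
      ∀ x : D.domain, R (z • (x : H) - D x) = x := by
  let G := D.graph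
  have hG : IsClosed (G : Set (H × H)) := hD.isClosed
  have : CompleteSpace G := hG.completeSpace_coe
  let f : G →L[ℂ] H := (z • ContinuousLinearMap.fst ℂ H H - ContinuousLinearMap.snd ℂ H H).comp
    G.subtypeL
  have hzpos : 0 < |z.im| := abs_pos.2 hz
  have hGmem (g : G) : ∃ h : (g : H × H).1 ∈ D.domain, D ⟨(g : H × H).1, h⟩ = (g : H × H).2 := by
    obtain ⟨y, hy1, hy2⟩ := LinearPMap.mem_graph_iff D |>.1 g.2
    refine ⟨hy1 ▸ y.2, ?_⟩
    rw [← hy2]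
    congr 1
    exact Subtype.ext hy1.symm
  have hb1 (g : G) : ‖(g : H × H).1‖ ≤ |z.im|⁻¹ * ‖f g‖ := by
    obtain ⟨h1, h2⟩ := hGmem g
    have := abs_im_mul_norm_le hD z ⟨_, h1⟩
    rw [h2] at this
    rw [← div_eq_inv_mul, le_div_iff₀ hzpos, mul_comm]
    exact this
  have hb (g : G) : ‖g‖ ≤ (1 + (1 + ‖z‖) * |z.im|⁻¹) * ‖f g‖ := by
    have h1 := hb1 g
    have h2 : ‖(g : H × H).2‖ ≤ ‖z‖ * ‖(g : H × H).1‖ + ‖f g‖ := by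
      have : (g : H × H).2 = z • (g : H × H).1 - f g := by
        change _ = z • (g : H × H).1 - (z • (g : H × H).1 - (g : H × H).2)
        abel
      rw [this]
      exact (norm_sub_le _ _).trans (by rw [norm_smul])
    have h3 : ‖g‖ ≤ ‖(g : H × H).1‖ + ‖(g : H × H).2‖ :=
      max_le (le_add_of_nonneg_right (norm_nonneg _)) (le_add_of_nonneg_left (norm_nonneg _))
    have h4 := mul_le_mul_of_nonneg_left h1 (norm_nonneg z)
    nlinarith
  have hK : 0 ≤ 1 + (1 + ‖z‖) * |z.im|⁻¹ := by positivity
  have hanti : AntilipschitzWith ⟨_, hK⟩ f := f.antilipschitz_of_bound hb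
  have hclosed : IsClosed (f.range : Set H) := by
    have h := hanti.isClosed_range f.uniformContinuous
    exact h
  have hbot : f.rangeᗮ = ⊥ := by
    rw [Submodule.eq_bot_iff]
    intro y hy
    have h1 : ∀ x : D.domain, inner ℂ ((starRingEnd ℂ z) • y) (x : H) = inner ℂ y (D x) := by
      intro x
      have := (Submodule.mem_orthogonal' _ _).1 hy _
        ⟨⟨((x : H), D x), LinearPMap.mem_graph D x⟩, rfl⟩
      change inner ℂ y (z • (x : H) - D x) = 0 at this
      rw [inner_sub_right, sub_eq_zero, inner_smul_right] at this
      rw [inner_smul_left, Complex.conj_conj, this]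
    obtain ⟨h2, h3⟩ := exists_mem_domain_of_inner hD h1
    have h4 := abs_im_mul_norm_le hD (starRingEnd ℂ z) ⟨y, h2⟩
    rw [h3, sub_self, norm_zero, Complex.conj_im, abs_neg] at h4
    have : ‖y‖ ≤ 0 := by
      by_contra! h
      exact absurd h4 (not_le.2 (mul_pos hzpos h))
    exact norm_le_zero_iff.1 this
  have hrange : f.range = ⊤ := by
    have : CompleteSpace f.range := hclosed.completeSpace_coe
    rw [← Submodule.orthogonal_orthogonal f.range, hbot, Submodule.bot_orthogonal_eq_top]
  let e := ContinuousLinearEquiv.ofBijective f (LinearMap.ker_eq_bot.2 hanti.injective) hrange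
  refine ⟨((ContinuousLinearMap.fst ℂ H H).comp G.subtypeL).comp (e.symm : H →L[ℂ] G), ?_, ?_⟩
  · intro y
    obtain ⟨h1, h2⟩ := hGmem (e.symm y)
    refine ⟨h1, ?_⟩
    have h3 : f (e.symm y) = y := e.apply_symm_apply y
    change z • (e.symm y : H × H).1 - (e.symm y : H × H).2 = y at h3
    change D ⟨(e.symm y : H × H).1, h1⟩ = z • (e.symm y : H × H).1 - y
    rw [h2]
    nth_rw 3 [← h3]
    abel
  · intro x
    have h1 : e ⟨((x : H), D x), LinearPMap.mem_graph D x⟩ = z • (x : H) - D x := rfl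
    change ((e.symm (z • (x : H) - D x) : G) : H × H).1 = x
    rw [← h1, e.symm_apply_apply]

theorem isBoundedInverse_resolventOp (hD : IsSelfAdjoint D) {z : ℂ} (hz : z.im ≠ 0) :
    (∀ y, ∃ h : resolventOp D z y ∈ D.domain,
      D ⟨resolventOp D z y, h⟩ = z • resolventOp D z y - y) ∧
      ∀ x : D.domain, resolventOp D z (z • (x : H) - D x) = x := by
  obtain ⟨R, h1, h2⟩ := exists_isBoundedInverse hD hz
  have hR : IsBoundedInverse ((z • LinearMap.id : H →ₗ[ℂ] H) +ᵥ (-D)) R := by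
    refine ⟨fun y => ?_, fun x => ?_⟩
    · obtain ⟨h3, h4⟩ := h1 y
      refine ⟨h3, ?_⟩
      change z • R y + -D ⟨R y, h3⟩ = y
      rw [h4]; abel
    · change R (z • (x : H) + -D x) = x
      rw [← sub_eq_add_neg]
      exact h2 x
  rw [resolventOp, boundedInverse_eq hR]
  exact ⟨h1, h2⟩

theorem apply_resolventOp_mem (hD : IsSelfAdjoint D) {z : ℂ} (hz : z.im ≠ 0) (y : H) :
    resolventOp D z y ∈ D.domain :=
  ((isBoundedInverse_resolventOp hD hz).1 y).1

theorem apply_resolventOp (hD : IsSelfAdjoint D) {z : ℂ} (hz : z.im ≠ 0) (y : H) :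
    D ⟨resolventOp D z y, apply_resolventOp_mem hD hz y⟩ = z • resolventOp D z y - y :=
  ((isBoundedInverse_resolventOp hD hz).1 y).2

theorem resolventOp_apply_sub (hD : IsSelfAdjoint D) {z : ℂ} (hz : z.im ≠ 0) (x : D.domain) :
    resolventOp D z (z • (x : H) - D x) = x :=
  (isBoundedInverse_resolventOp hD hz).2 x

theorem star_resolventOp (hD : IsSelfAdjoint D) {z : ℂ} (hz : z.im ≠ 0) :
    star (resolventOp D z) = resolventOp D (starRingEnd ℂ z) := by
  have hz' : (starRingEnd ℂ z).im ≠ 0 := by simpa using hz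
  rw [ContinuousLinearMap.star_eq_adjoint, eq_comm, ContinuousLinearMap.eq_adjoint_iff]
  intro x y
  set u := resolventOp D (starRingEnd ℂ z) x
  set v := resolventOp D z y
  have hu := apply_resolventOp hD hz' x
  have hv := apply_resolventOp hD hz y
  have h := inner_apply_comm hD ⟨u, apply_resolventOp_mem hD hz' x⟩
    ⟨v, apply_resolventOp_mem hD hz y⟩
  rw [hu, hv, inner_sub_left, inner_sub_right, inner_smul_left, inner_smul_right,
    Complex.conj_conj] at h
  exact (sub_right_injective h).symm

theorem resolventOp_sub (hD : IsSelfAdjoint D) {z w : ℂ} (hz : z.im ≠ 0) (hw : w.im ≠ 0) :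
    resolventOp D z - resolventOp D w = (w - z) • (resolventOp D z * resolventOp D w) := by
  ext y
  have h := resolventOp_apply_sub hD hz ⟨_, apply_resolventOp_mem hD hw y⟩
  rw [apply_resolventOp hD hw] at h
  simp only [map_sub, map_smul] at h
  simp only [sub_apply, smul_apply, mul_apply_eq_comp,
    sub_smul]
  calc resolventOp D z y - resolventOp D w y
      = resolventOp D z y - (z • resolventOp D z (resolventOp D w y) -
          (w • resolventOp D z (resolventOp D w y) - resolventOp D z y)) := by rw [h]
    _ = _ := by abel

theorem resolventOp_mem (hD : IsSelfAdjoint D) {N : VonNeumannAlgebra H} (hDN : IsAffiliated N D)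
    {z : ℂ} (hz : z.im ≠ 0) : resolventOp D z ∈ N := by
  refine mem_of_commute_commutant fun T hT => ?_
  ext y
  obtain ⟨h1, h2⟩ := hDN T hT ⟨_, apply_resolventOp_mem hD hz y⟩
  have h3 := resolventOp_apply_sub hD hz ⟨_, h1⟩
  rw [h2, apply_resolventOp hD hz] at h3
  change resolventOp D z (z • T (resolventOp D z y) - T (z • resolventOp D z y - y)) = _ at h3
  rw [map_sub T, map_smul T, sub_sub_cancel] at h3
  exact h3.symm

/-! ### Bounded perturbations -/

omit [CompleteSpace H] in
theorem perturb_perturb (A B : H →L[ℂ] H) : perturb (perturb D A) B = perturb D (B + A) := by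
  rw [perturb, perturb, perturb, ← add_vadd]
  rfl

theorem inner_isSelfAdjoint {A : H →L[ℂ] H} (hA : IsSelfAdjoint A) (x y : H) :
    inner ℂ (A x) y = inner ℂ x (A y) := by
  rw [← ContinuousLinearMap.adjoint_inner_right, ← ContinuousLinearMap.star_eq_adjoint, hA.star_eq]

theorem isSelfAdjoint_perturb (hD : IsSelfAdjoint D) {A : H →L[ℂ] H} (hA : IsSelfAdjoint A) :
    IsSelfAdjoint (perturb D A) := by
  refine isSelfAdjoint_of_inner (D := perturb D A) hD.dense_domain (fun x y => ?_)
    fun y w h => ?_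
  · change inner ℂ (A x + D x) (y : H) = inner ℂ (x : H) (A y + D y)
    rw [inner_add_left, inner_add_right, inner_isSelfAdjoint hA]
    exact congrArg (inner ℂ (x : H) (A y) + ·) (inner_apply_comm hD x y)
  · refine (exists_mem_domain_of_inner hD (y := y) (w := w - A y) fun x => ?_).1
    have := h x
    change inner ℂ w (x : H) = inner ℂ y (A x + D x) at this
    rw [inner_sub_left, this, inner_add_right, inner_isSelfAdjoint hA, add_sub_cancel_left]

theorem isAffiliated_perturb {N : VonNeumannAlgebra H} (hD : IsAffiliated N D) {A : H →L[ℂ] H}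
    (hA : A ∈ N) : IsAffiliated N (perturb D A) := by
  intro T hT x
  obtain ⟨h1, h2⟩ := hD T hT x
  refine ⟨h1, ?_⟩
  change A (T x) + D ⟨T x, h1⟩ = T (A x + D x)
  rw [h2, map_add]
  congr 1
  exact (congrArg (fun S : H →L[ℂ] H => S x) (commutant_commute hA hT).eq).symm

/-- Each term on the right contains the resolvent of `D` as a factor; thus membership in `J` passes
to bounded perturbations. -/
theorem resolventOp_perturb (hD : IsSelfAdjoint D) {A : H →L[ℂ] H} (hA : IsSelfAdjoint A) {z : ℂ}
    (hz : z.im ≠ 0) : resolventOp (perturb D A) z =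
      resolventOp D z + resolventOp D z * (A * resolventOp (perturb D A) z) := by
  have hD' := isSelfAdjoint_perturb hD hA
  ext y
  have h1 : resolventOp (perturb D A) z y ∈ D.domain := apply_resolventOp_mem hD' hz y
  have h := resolventOp_apply_sub hD hz ⟨_, h1⟩
  have h2 : A (resolventOp (perturb D A) z y) + D ⟨resolventOp (perturb D A) z y, h1⟩ =
      z • resolventOp (perturb D A) z y - y := apply_resolventOp hD' hz y
  have h3 : z • resolventOp (perturb D A) z y - D ⟨resolventOp (perturb D A) z y, h1⟩ =
      y + A (resolventOp (perturb D A) z y) := by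
    rw [eq_sub_of_add_eq' h2]; abel
  rw [h3, map_add] at h
  exact h.symm

end SelfAdjoint

/-! ### The bounded transform -/

section BoundedTransform

variable {D : H →ₗ.[ℂ] H}

/-- The operator `(1 + D²)⁻¹`. -/
def invOneAddSq (D : H →ₗ.[ℂ] H) : H →L[ℂ] H :=
  star (resolventOp D Complex.I) * resolventOp D Complex.I

/-- The operator `(1 + D²)^(-1/2)`. -/
def invSqrtOneAddSq (D : H →ₗ.[ℂ] H) : H →L[ℂ] H := CFC.sqrt (invOneAddSq D)

theorem I_im_ne_zero : Complex.I.im ≠ 0 := by simp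

theorem neg_I_im_ne_zero : (-Complex.I).im ≠ 0 := by simp

theorem star_resolventOp_I (hD : IsSelfAdjoint D) :
    star (resolventOp D Complex.I) = resolventOp D (-Complex.I) := by
  rw [star_resolventOp hD I_im_ne_zero, Complex.conj_I]

theorem invOneAddSq_apply (hD : IsSelfAdjoint D) (y : H) :
    ∃ (h₁ : invOneAddSq D y ∈ D.domain) (h₂ : D ⟨invOneAddSq D y, h₁⟩ ∈ D.domain),
      D ⟨invOneAddSq D y, h₁⟩ =
        -(Complex.I • invOneAddSq D y + resolventOp D Complex.I y) ∧
      D ⟨D ⟨invOneAddSq D y, h₁⟩, h₂⟩ = y - invOneAddSq D y := by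
  rw [invOneAddSq, star_resolventOp_I hD]
  simp only [mul_apply_eq_comp]
  have h1 := apply_resolventOp_mem hD neg_I_im_ne_zero (resolventOp D Complex.I y)
  have h2 := apply_resolventOp hD neg_I_im_ne_zero (resolventOp D Complex.I y)
  have h3 := apply_resolventOp_mem hD I_im_ne_zero y
  have h4 := apply_resolventOp hD I_im_ne_zero y
  have h5 : D ⟨resolventOp D (-Complex.I) (resolventOp D Complex.I y), h1⟩ =
      -(Complex.I • resolventOp D (-Complex.I) (resolventOp D Complex.I y) +
        resolventOp D Complex.I y) := by
    rw [h2, neg_smul]; abel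
  have h6 : D ⟨resolventOp D (-Complex.I) (resolventOp D Complex.I y), h1⟩ ∈ D.domain := by
    rw [h5]
    exact D.domain.neg_mem (D.domain.add_mem (D.domain.smul_mem _ h1) h3)
  refine ⟨h1, h6, h5, ?_⟩
  have h7 : (⟨D ⟨resolventOp D (-Complex.I) (resolventOp D Complex.I y), h1⟩, h6⟩ : D.domain) =
      -(Complex.I • ⟨resolventOp D (-Complex.I) (resolventOp D Complex.I y), h1⟩ +
        ⟨resolventOp D Complex.I y, h3⟩) := Subtype.ext h5
  rw [h7, D.map_neg, D.map_add, D.map_smul, h5, h4, smul_neg, smul_add, smul_smul, Complex.I_mul_I]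
  module

theorem isBoundedInverse_invOneAddSq (hD : IsSelfAdjoint D) :
    IsBoundedInverse ((LinearMap.id : H →ₗ[ℂ] H) +ᵥ sqPMap D) (invOneAddSq D) := by
  have hdom (x : H) : x ∈ ((LinearMap.id : H →ₗ[ℂ] H) +ᵥ sqPMap D).domain ↔
      ∃ h : x ∈ D.domain, D ⟨x, h⟩ ∈ D.domain := by
    change x ∈ ((D.domain.comap D.toFun).map D.domain.subtype) ⊓ D.domain ↔ _
    constructor
    · rintro ⟨⟨⟨z, hz⟩, hz1, rfl⟩, -⟩
      exact ⟨hz, hz1⟩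
    · rintro ⟨h1, h2⟩
      exact ⟨⟨⟨x, h1⟩, h2, rfl⟩, h1⟩
  have happ (x : H) (hx : x ∈ ((LinearMap.id : H →ₗ[ℂ] H) +ᵥ sqPMap D).domain)
      (h1 : x ∈ D.domain) (h2 : D ⟨x, h1⟩ ∈ D.domain) :
      ((LinearMap.id : H →ₗ[ℂ] H) +ᵥ sqPMap D) ⟨x, hx⟩ = x + D ⟨D ⟨x, h1⟩, h2⟩ := rfl
  refine ⟨fun y => ?_, fun x => ?_⟩
  · obtain ⟨h1, h2, h3, h4⟩ := invOneAddSq_apply hD y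
    have h5 := (hdom _).2 ⟨h1, h2⟩
    refine ⟨h5, ?_⟩
    rw [happ _ h5 h1 h2, h4, add_sub_cancel]
  · obtain ⟨x, hx⟩ := x
    obtain ⟨h1, h2⟩ := (hdom x).1 hx
    rw [happ _ hx h1 h2, invOneAddSq, star_resolventOp_I hD, mul_apply_eq_comp]
    -- The factorisation `1 + D² = (i - D)(-i - D)`, undone by one resolvent at a time.
    have e1 : x + D ⟨D ⟨x, h1⟩, h2⟩ =
        Complex.I • (((-Complex.I) • (⟨x, h1⟩ : D.domain) - ⟨D ⟨x, h1⟩, h2⟩ : D.domain) : H) -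
          D ((-Complex.I) • (⟨x, h1⟩ : D.domain) - ⟨D ⟨x, h1⟩, h2⟩) := by
      rw [D.map_sub, D.map_smul]
      simp only [Submodule.coe_sub, Submodule.coe_smul, smul_sub, smul_smul]
      simp
      abel
    rw [e1, resolventOp_apply_sub hD I_im_ne_zero]
    exact resolventOp_apply_sub hD neg_I_im_ne_zero ⟨x, h1⟩

theorem invOneAddSq_nonneg (D : H →ₗ.[ℂ] H) : 0 ≤ invOneAddSq D := star_mul_self_nonneg _

theorem invSqrtOneAddSq_nonneg (D : H →ₗ.[ℂ] H) : 0 ≤ invSqrtOneAddSq D := CFC.sqrt_nonneg _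

theorem isSelfAdjoint_invSqrtOneAddSq (D : H →ₗ.[ℂ] H) : IsSelfAdjoint (invSqrtOneAddSq D) :=
  (invSqrtOneAddSq_nonneg D).isSelfAdjoint

theorem invSqrtOneAddSq_mul_self (D : H →ₗ.[ℂ] H) :
    invSqrtOneAddSq D * invSqrtOneAddSq D = invOneAddSq D :=
  CFC.sqrt_mul_sqrt_self _ (invOneAddSq_nonneg D)

theorem invSqrtOneAddSq_apply_apply (D : H →ₗ.[ℂ] H) (x : H) :
    invSqrtOneAddSq D (invSqrtOneAddSq D x) = invOneAddSq D x :=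
  congrArg (fun A : H →L[ℂ] H => A x) (invSqrtOneAddSq_mul_self D)

/-- A self-adjoint operator with trivial kernel has dense range, and the square `(1 + D²)⁻¹` is
already injective. -/
theorem denseRange_invSqrtOneAddSq (hD : IsSelfAdjoint D) : DenseRange (invSqrtOneAddSq D) := by
  have hk : (invSqrtOneAddSq D).ker = ⊥ := by
    rw [Submodule.eq_bot_iff]
    intro x hx
    have hx' : invSqrtOneAddSq D x = 0 := hx
    obtain ⟨h1, h2, h3, h4⟩ := invOneAddSq_apply hD x
    have h0 : invOneAddSq D x = 0 := by rw [← invSqrtOneAddSq_apply_apply, hx', map_zero]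
    have h5 : (⟨invOneAddSq D x, h1⟩ : D.domain) = 0 := Subtype.ext h0
    have h6 : (⟨D ⟨invOneAddSq D x, h1⟩, h2⟩ : D.domain) = 0 :=
      Subtype.ext (by simp only [h5, D.map_zero]; rfl)
    rw [h6, D.map_zero, h0, sub_zero] at h4
    exact h4.symm
  have h := ContinuousLinearMap.orthogonal_ker (invSqrtOneAddSq D)
  rw [hk, Submodule.bot_orthogonal_eq_top, ← ContinuousLinearMap.star_eq_adjoint,
    (isSelfAdjoint_invSqrtOneAddSq D).star_eq] at h
  have := Submodule.dense_iff_topologicalClosure_eq_top.2 h.symm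
  exact this

/-- The operator `D (1 + D²)⁻¹`. -/
def mulInvOneAddSq (D : H →ₗ.[ℂ] H) : H →L[ℂ] H :=
  -(Complex.I • invOneAddSq D + resolventOp D Complex.I)

theorem resolventOp_neg_I_sub (hD : IsSelfAdjoint D) :
    resolventOp D (-Complex.I) - resolventOp D Complex.I = (2 * Complex.I) • invOneAddSq D := by
  rw [resolventOp_sub hD neg_I_im_ne_zero I_im_ne_zero, invOneAddSq, star_resolventOp_I hD]
  congr 1
  ring

theorem isSelfAdjoint_mulInvOneAddSq (hD : IsSelfAdjoint D) : IsSelfAdjoint (mulInvOneAddSq D) := by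
  have h := resolventOp_neg_I_sub hD
  rw [IsSelfAdjoint, mulInvOneAddSq, star_neg, star_add, star_smul,
    (invOneAddSq_nonneg D).isSelfAdjoint.star_eq, star_resolventOp_I hD, sub_eq_iff_eq_add.1 h]
  simp only [Complex.star_def, Complex.conj_I]
  module

theorem commute_resolventOp_invOneAddSq (hD : IsSelfAdjoint D) :
    Commute (resolventOp D Complex.I) (invOneAddSq D) := by
  have h : Commute (resolventOp D Complex.I) (resolventOp D (-Complex.I)) := by
    have h1 := resolventOp_sub hD neg_I_im_ne_zero I_im_ne_zero
    have h2 := resolventOp_sub hD I_im_ne_zero neg_I_im_ne_zero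
    rw [← neg_sub, h1, ← neg_smul] at h2
    have h3 : (-(Complex.I - -Complex.I)) ≠ 0 := by
      intro h
      have := congrArg Complex.im h
      norm_num at this
    have h4 : -Complex.I - Complex.I = -(Complex.I - -Complex.I) := by ring
    rw [h4] at h2
    exact (smul_right_injective _ h3 h2).symm
  rw [invOneAddSq, star_resolventOp_I hD]
  exact h.mul_right (Commute.refl _)

theorem mulInvOneAddSq_mul_self (hD : IsSelfAdjoint D) :
    mulInvOneAddSq D * mulInvOneAddSq D =
      (1 - invOneAddSq D) * invOneAddSq D := by
  have h1 := (isSelfAdjoint_mulInvOneAddSq hD).star_eq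
  have hsub := resolventOp_neg_I_sub hD
  have hc := (commute_resolventOp_invOneAddSq hD).eq
  have hRR : resolventOp D Complex.I * resolventOp D (-Complex.I) = invOneAddSq D := by
    have h2 := resolventOp_sub hD I_im_ne_zero neg_I_im_ne_zero
    rw [← neg_sub, hsub, ← neg_smul] at h2
    have h3 : (-(2 * Complex.I)) ≠ 0 := by simp
    have h4 : -Complex.I - Complex.I = -(2 * Complex.I) := by ring
    rw [h4] at h2
    exact (smul_right_injective _ h3 h2).symm
  nth_rw 2 [← h1]
  rw [mulInvOneAddSq, star_neg, star_add, star_smul, (invOneAddSq_nonneg D).isSelfAdjoint.star_eq,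
    star_resolventOp_I hD]
  set R := invOneAddSq D
  set r := resolventOp D Complex.I
  set s := resolventOp D (-Complex.I)
  have hs : s = (2 * Complex.I) • R + r := sub_eq_iff_eq_add.1 hsub
  rw [neg_mul_neg, add_mul, mul_add, mul_add, hRR, hs]
  simp only [Complex.star_def, Complex.conj_I, smul_mul_assoc, mul_smul_comm, mul_add, hc, sub_mul,
    one_mul, smul_smul]
  match_scalars <;> ring_nf <;> norm_num [Complex.I_sq]

/-- With `R = (1 + D²)⁻¹`, the left side squared is `⟨R x, x⟩ - ‖R x‖²` and the right side squared
is `⟨R x, x⟩`. -/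
theorem norm_mulInvOneAddSq_apply_le (hD : IsSelfAdjoint D) (x : H) :
    ‖mulInvOneAddSq D x‖ ≤ ‖invSqrtOneAddSq D x‖ := by
  have hB := isSelfAdjoint_mulInvOneAddSq hD
  have hS := isSelfAdjoint_invSqrtOneAddSq D
  have hR : IsSelfAdjoint (invOneAddSq D) := (invOneAddSq_nonneg D).isSelfAdjoint
  have h {T : H →L[ℂ] H} (hT : IsSelfAdjoint T) :
      ‖T x‖ ^ 2 = RCLike.re (inner ℂ ((T * T) x) x) := by
    rw [← inner_self_eq_norm_sq (𝕜 := ℂ), mul_apply_eq_comp, inner_isSelfAdjoint hT (T x)]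
  have h1 := h hB
  rw [mulInvOneAddSq_mul_self hD, sub_mul, one_mul, sub_apply, inner_sub_left, map_sub, ← h hR,
    ← invSqrtOneAddSq_mul_self, ← h hS] at h1
  exact (sq_le_sq₀ (norm_nonneg _) (norm_nonneg _)).1 (by nlinarith [sq_nonneg ‖invOneAddSq D x‖])

/-- By the preceding estimate `S x ↦ D S² x` extends from the dense range of `S` to a bounded `F`.
The identity `⟨F x, z⟩ = ⟨S x, D z⟩` holds on that range, hence everywhere, and self-adjointness
then puts `S x` into the domain. -/
theorem exists_boundedTransform (hD : IsSelfAdjoint D) :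
    ∃ F : H →L[ℂ] H, F * invSqrtOneAddSq D = mulInvOneAddSq D ∧
      ∀ x, ∃ h : invSqrtOneAddSq D x ∈ D.domain, D ⟨invSqrtOneAddSq D x, h⟩ = F x := by
  set S := invSqrtOneAddSq D
  have hd : DenseRange (S : H →ₗ[ℂ] H) := denseRange_invSqrtOneAddSq hD
  set F := (mulInvOneAddSq D : H →ₗ[ℂ] H).extendOfNorm (S : H →ₗ[ℂ] H)
  have hF (x : H) : F (S x) = mulInvOneAddSq D x :=
    LinearMap.extendOfNorm_eq hd ⟨1, fun x => by
      rw [one_mul]; exact norm_mulInvOneAddSq_apply_le hD x⟩ x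
  refine ⟨F, ContinuousLinearMap.ext hF, fun x => exists_mem_domain_of_inner hD fun z => ?_⟩
  have hc1 : Continuous fun x => inner ℂ (F x) (z : H) := by fun_prop
  have hc2 : Continuous fun x => inner ℂ (S x) (D z) := by fun_prop
  refine congrFun ((denseRange_invSqrtOneAddSq hD).equalizer hc1 hc2 (funext fun w => ?_)) x
  obtain ⟨h1, h2, h3, h4⟩ := invOneAddSq_apply hD w
  have h5 := inner_apply_comm hD ⟨_, h1⟩ z
  rw [h3] at h5
  change inner ℂ (F (S w)) (z : H) = inner ℂ (S (S w)) (D z)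
  rw [hF, invSqrtOneAddSq_apply_apply, ← h5]
  rfl

theorem boundedTransform_spec (hD : IsSelfAdjoint D) :
    boundedTransform D * invSqrtOneAddSq D = mulInvOneAddSq D ∧
      ∀ x, ∃ h : invSqrtOneAddSq D x ∈ D.domain,
        D ⟨invSqrtOneAddSq D x, h⟩ = boundedTransform D x := by
  obtain ⟨F, h1, h2⟩ := exists_boundedTransform hD
  have h3 : boundedTransform D = F := by
    rw [boundedTransform, boundedInverse_eq (isBoundedInverse_invOneAddSq hD)]
    exact compBounded_eq h2
  rw [h3]
  exact ⟨h1, h2⟩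

omit [CompleteSpace H] in
theorem eq_of_mul_denseRange {V W S : H →L[ℂ] H} (hS : DenseRange S) (h : V * S = W * S) :
    V = W :=
  ContinuousLinearMap.ext fun x => congrFun (hS.equalizer V.continuous W.continuous
    (funext fun w => congrArg (fun A : H →L[ℂ] H => A w) h)) x

theorem commute_mulInvOneAddSq (hD : IsSelfAdjoint D) :
    Commute (mulInvOneAddSq D) (invSqrtOneAddSq D) := by
  have h1 : Commute (mulInvOneAddSq D) (invOneAddSq D) :=
    (((Commute.refl (invOneAddSq D)).smul_left _).add_left
      (commute_resolventOp_invOneAddSq hD)).neg_left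
  rw [invSqrtOneAddSq, CFC.sqrt_eq_cfc]
  exact (h1.symm.cfc_nnreal _).symm

theorem commute_boundedTransform (hD : IsSelfAdjoint D) :
    Commute (boundedTransform D) (invSqrtOneAddSq D) := by
  have h := (boundedTransform_spec hD).1
  refine eq_of_mul_denseRange (denseRange_invSqrtOneAddSq hD) ?_
  rw [mul_assoc, mul_assoc, h, ← mul_assoc, h, (commute_mulInvOneAddSq hD).eq]

theorem isSelfAdjoint_boundedTransform (hD : IsSelfAdjoint D) :
    IsSelfAdjoint (boundedTransform D) := by
  have h := (boundedTransform_spec hD).1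
  refine eq_of_mul_denseRange (denseRange_invSqrtOneAddSq hD) ?_
  have h1 := congrArg star ((commute_boundedTransform hD).eq.symm.trans h)
  rw [star_mul, (isSelfAdjoint_invSqrtOneAddSq D).star_eq,
    (isSelfAdjoint_mulInvOneAddSq hD).star_eq] at h1
  rw [h1, h]

theorem boundedTransform_mul_self (hD : IsSelfAdjoint D) :
    boundedTransform D * boundedTransform D =
      1 - invSqrtOneAddSq D * invSqrtOneAddSq D := by
  have h := (boundedTransform_spec hD).1
  have hc := (commute_boundedTransform hD).eq
  have hd := denseRange_invSqrtOneAddSq hD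
  -- Cancelling the dense-range factor `S` twice reduces the claim to the square of `D (1 + D²)⁻¹`.
  refine eq_of_mul_denseRange hd (eq_of_mul_denseRange hd ?_)
  have h1 := mulInvOneAddSq_mul_self hD
  rw [← h, ← invSqrtOneAddSq_mul_self] at h1
  calc _ = boundedTransform D * (boundedTransform D * invSqrtOneAddSq D) * invSqrtOneAddSq D := by
        simp only [mul_assoc]
    _ = _ := by
        rw [hc, mul_assoc, mul_assoc, ← mul_assoc, h1, mul_assoc]

theorem norm_le_one_of_add_eq_one {V W : H →L[ℂ] H} (hV : IsSelfAdjoint V) (hW : IsSelfAdjoint W)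
    (h : V * V = 1 - W * W) : ‖V‖ ≤ 1 := by
  refine ContinuousLinearMap.opNorm_le_bound _ zero_le_one fun x => ?_
  have key {T : H →L[ℂ] H} (hT : IsSelfAdjoint T) :
      ‖T x‖ ^ 2 = RCLike.re (inner ℂ ((T * T) x) x) := by
    rw [← inner_self_eq_norm_sq (𝕜 := ℂ), mul_apply_eq_comp, inner_isSelfAdjoint hT (T x)]
  have h1 := key hV
  rw [h, sub_apply, inner_sub_left, map_sub, ← key hW, one_apply_eq_self,
    inner_self_eq_norm_sq] at h1
  rw [one_mul]
  exact (sq_le_sq₀ (norm_nonneg _) (norm_nonneg _)).1 (by nlinarith [sq_nonneg ‖W x‖])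

theorem norm_boundedTransform_le (hD : IsSelfAdjoint D) : ‖boundedTransform D‖ ≤ 1 :=
  norm_le_one_of_add_eq_one (isSelfAdjoint_boundedTransform hD)
    (isSelfAdjoint_invSqrtOneAddSq D) (boundedTransform_mul_self hD)

theorem norm_invSqrtOneAddSq_le (hD : IsSelfAdjoint D) : ‖invSqrtOneAddSq D‖ ≤ 1 :=
  norm_le_one_of_add_eq_one (isSelfAdjoint_invSqrtOneAddSq D)
    (isSelfAdjoint_boundedTransform hD) (by rw [boundedTransform_mul_self hD, sub_sub_cancel])

theorem invOneAddSq_mem (hD : IsSelfAdjoint D) {N : VonNeumannAlgebra H} (hDN : IsAffiliated N D) :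
    invOneAddSq D ∈ N :=
  mul_mem (star_mem (resolventOp_mem hD hDN I_im_ne_zero)) (resolventOp_mem hD hDN I_im_ne_zero)

theorem invSqrtOneAddSq_mem (hD : IsSelfAdjoint D) {N : VonNeumannAlgebra H}
    (hDN : IsAffiliated N D) : invSqrtOneAddSq D ∈ N := by
  refine mem_of_commute_commutant fun T hT => ?_
  rw [invSqrtOneAddSq, CFC.sqrt_eq_cfc]
  exact ((commutant_commute (invOneAddSq_mem hD hDN) hT).symm.cfc_nnreal _).symm

theorem boundedTransform_mem (hD : IsSelfAdjoint D) {N : VonNeumannAlgebra H}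
    (hDN : IsAffiliated N D) : boundedTransform D ∈ N := by
  refine mem_of_commute_commutant fun T hT => ?_
  refine eq_of_mul_denseRange (denseRange_invSqrtOneAddSq hD) ?_
  have h := (boundedTransform_spec hD).1
  have h1 : Commute T (invSqrtOneAddSq D) := commutant_commute (invSqrtOneAddSq_mem hD hDN) hT
  have h2 : Commute T (mulInvOneAddSq D) := by
    refine Commute.neg_right (Commute.add_right (Commute.smul_right ?_ _) ?_)
    · exact commutant_commute (invOneAddSq_mem hD hDN) hT
    · exact commutant_commute (resolventOp_mem hD hDN I_im_ne_zero) hT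
  rw [mul_assoc, h, h2.eq, mul_assoc, h1.eq, ← mul_assoc, h]

/-! ### Dependence of the bounded transform on the operator -/

/-- Formally both sides are `S' (D' - D) S`. Tested in inner products, the symmetry of `D' = D + A`
moves it onto `S' y`, so no unbounded product appears. -/
theorem invSqrt_mul_mul_invSqrt (hD : IsSelfAdjoint D) {A : H →L[ℂ] H} (hA : IsSelfAdjoint A) :
    invSqrtOneAddSq (perturb D A) * A * invSqrtOneAddSq D =
      boundedTransform (perturb D A) * invSqrtOneAddSq D -
        invSqrtOneAddSq (perturb D A) * boundedTransform D := by
  have hD' := isSelfAdjoint_perturb hD hA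
  set S := invSqrtOneAddSq D
  set S' := invSqrtOneAddSq (perturb D A)
  have hS' : IsSelfAdjoint S' := isSelfAdjoint_invSqrtOneAddSq _
  have hF' := isSelfAdjoint_boundedTransform hD'
  ext x
  refine ext_inner_right ℂ fun y => ?_
  obtain ⟨h1, h2⟩ := (boundedTransform_spec hD).2 x
  obtain ⟨h3, h4⟩ := (boundedTransform_spec hD').2 y
  have h5 := inner_apply_comm hD' ⟨S x, h1⟩ ⟨S' y, h3⟩
  rw [h4] at h5
  change inner ℂ (A (S x) + D ⟨S x, h1⟩) (S' y) =
    inner ℂ (S x) (boundedTransform (perturb D A) y) at h5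
  rw [h2, inner_add_left] at h5
  simp only [mul_apply_eq_comp, sub_apply, inner_sub_left]
  rw [inner_isSelfAdjoint hS', inner_isSelfAdjoint hS', inner_isSelfAdjoint hF', ← h5,
    add_sub_cancel_right]

theorem boundedTransform_sylvester (hD : IsSelfAdjoint D) {A : H →L[ℂ] H} (hA : IsSelfAdjoint A) :
    invSqrtOneAddSq (perturb D A) * (boundedTransform (perturb D A) - boundedTransform D) +
        (boundedTransform (perturb D A) - boundedTransform D) * invSqrtOneAddSq D =
      invSqrtOneAddSq (perturb D A) * (A +
        invSqrtOneAddSq (perturb D A) * A * invSqrtOneAddSq D -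
        boundedTransform (perturb D A) * A * boundedTransform D) * invSqrtOneAddSq D := by
  have hD' := isSelfAdjoint_perturb hD hA
  have h1 := invSqrt_mul_mul_invSqrt hD hA
  have hF := boundedTransform_mul_self hD
  have hF' := boundedTransform_mul_self hD'
  have hc := (commute_boundedTransform hD).eq
  have hc' := (commute_boundedTransform hD').eq
  set S := invSqrtOneAddSq D
  set S' := invSqrtOneAddSq (perturb D A)
  set F := boundedTransform D
  set F' := boundedTransform (perturb D A)
  have e : S' * (A + S' * A * S - F' * A * F) * S =
      S' * A * S + S' * (S' * A * S) * S - F' * (S' * A * S) * F := by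
    calc _ = S' * A * S + S' * (S' * A * S) * S - (S' * F') * A * (F * S) := by noncomm_ring
      _ = S' * A * S + S' * (S' * A * S) * S - (F' * S') * A * (S * F) := by rw [hc, hc']
      _ = _ := by noncomm_ring
  have e2 : F' * (F' * S - S' * F) * F = (F' * F') * (F * S) - S' * F' * (F * F) := by
    rw [hc, ← hc']; noncomm_ring
  have e3 : S' * (F' * S - S' * F) * S = S' * F' * (S * S) - S' * S' * (F * S) := by
    noncomm_ring
  -- After `S' A S = F' S - S' F` is inserted throughout, the relations `F² = 1 - S²` and `F'² = 1 -
  -- S'²` make the triple products cancel.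
  rw [e, h1, e2, e3, hF, hF']
  rw [mul_sub, sub_mul, mul_sub, sub_mul, one_mul, mul_one, hc]
  abel

/-- The right-hand side of the Sylvester equation is a sum of three terms of norm at most `‖A‖`, and
solving the equation gains the factor `1 / 2`. -/
theorem norm_boundedTransform_sub_le (hD : IsSelfAdjoint D) {A : H →L[ℂ] H}
    (hA : IsSelfAdjoint A) :
    ‖boundedTransform (perturb D A) - boundedTransform D‖ ≤ 3 / 2 * ‖A‖ := by
  have hD' := isSelfAdjoint_perturb hD hA
  refine (norm_le_of_sylvester (invSqrtOneAddSq_nonneg _) (invSqrtOneAddSq_nonneg _)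
    (denseRange_invSqrtOneAddSq hD') (denseRange_invSqrtOneAddSq hD)
    (boundedTransform_sylvester hD hA) (norm_invSqrtOneAddSq_le hD')
    (norm_invSqrtOneAddSq_le hD)).trans ?_
  have key {V W : H →L[ℂ] H} (hV : ‖V‖ ≤ 1) (hW : ‖W‖ ≤ 1) : ‖V * A * W‖ ≤ ‖A‖ := by
    refine (norm_mul_le _ _).trans ((mul_le_of_le_one_right (norm_nonneg _) hW).trans ?_)
    exact (norm_mul_le _ _).trans (mul_le_of_le_one_left (norm_nonneg _) hV)
  have h1 := key (norm_invSqrtOneAddSq_le hD') (norm_invSqrtOneAddSq_le hD)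
  have h2 := key (norm_boundedTransform_le hD') (norm_boundedTransform_le hD)
  have h3 := norm_sub_le (A + invSqrtOneAddSq (perturb D A) * A * invSqrtOneAddSq D)
    (boundedTransform (perturb D A) * A * boundedTransform D)
  have h4 := norm_add_le A (invSqrtOneAddSq (perturb D A) * A * invSqrtOneAddSq D)
  linarith

theorem IsClosedIdeal.boundedTransform_sub_mem {N : VonNeumannAlgebra H}
    {J : NonUnitalSubalgebra ℂ (H →L[ℂ] H)} (hJ : IsClosedIdeal N J) (hD : IsSelfAdjoint D)
    (hDN : IsAffiliated N D) (hDJ : resolventOp D Complex.I ∈ J) {A : H →L[ℂ] H}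
    (hA : IsSelfAdjoint A) (hAN : A ∈ N) (hDJ' : resolventOp (perturb D A) Complex.I ∈ J) :
    boundedTransform (perturb D A) - boundedTransform D ∈ J := by
  have hD' := isSelfAdjoint_perturb hD hA
  have hDN' := isAffiliated_perturb hDN hAN
  refine hJ.mem_of_sylvester (invSqrtOneAddSq_nonneg _) (invSqrtOneAddSq_nonneg _)
    (invSqrtOneAddSq_mem hD' hDN') (invSqrtOneAddSq_mem hD hDN)
    (sub_mem (boundedTransform_mem hD' hDN') (boundedTransform_mem hD hDN)) ?_ ?_
    (denseRange_invSqrtOneAddSq hD') (denseRange_invSqrtOneAddSq hD)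
    (boundedTransform_sylvester hD hA)
  · rw [invSqrtOneAddSq_mul_self]
    exact hJ.mul_mem_left _ (star_mem (resolventOp_mem hD' hDN' I_im_ne_zero)) _ hDJ'
  · rw [invSqrtOneAddSq_mul_self]
    exact hJ.mul_mem_left _ (star_mem (resolventOp_mem hD hDN I_im_ne_zero)) _ hDJ

end BoundedTransform

/-! ### Spectral flow of paths whose spectral projections agree modulo the ideal -/

theorem sum_castSucc_sub_succ {G : Type*} [AddCommGroup G] {n : ℕ} (d : Fin (n + 1) → G) :
    ∑ i : Fin n, (d i.castSucc - d i.succ) = d 0 - d (Fin.last n) := by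
  induction n with
  | zero => simp
  | succ n ih =>
    rw [Fin.sum_univ_castSucc]
    have := ih fun i => d i.castSucc
    simp only [Fin.castSucc_zero] at this
    simp only [Fin.succ_castSucc, this, Fin.succ_last]
    abel

/-- Quotient distances between the spectral projections vanish, so even the one-interval partition
is admissible. Relative classes over the base point `χ(B 0)` make the sum over any partition
telescope. -/
theorem hasSpectralFlow_of_chi_sub_mem {N : VonNeumannAlgebra H}
    {J : NonUnitalSubalgebra ℂ (H →L[ℂ] H)} (hJ : IsClosedIdeal N J) {B : I → H →L[ℂ] H}
    (hB : IsFredholmPath N J B) (h : ∀ s t, chi (B s) - chi (B t) ∈ J) :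
    HasSpectralFlow N J B
      (projClass J (interProj (1 - chi (B 1)) (chi (B 0))) -
        projClass J (interProj (1 - chi (B 0)) (chi (B 1)))) := by
  have hN t : chi (B t) ∈ N := chi_mem (hB.2 t).2.1
  have hs t : IsStarProjection (chi (B t)) := isStarProjection_chi _
  have hint s t : interProj (1 - chi (B t)) (chi (B s)) ∈ J :=
    hJ.interProj_mem (hs s) (hs t) (hN s) (hN t) (h s t)
  refine ⟨hB, ⟨⟨1, ![0, 1], ?_, rfl, rfl, ?_⟩⟩, fun P => ⟨fun i => ⟨hint _ _, hint _ _⟩, ?_⟩⟩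
  · rw [Fin.strictMono_iff_lt_succ]
    intro i
    fin_cases i
    exact zero_lt_one
  · intro i s _ u _
    rw [quotNorm, Metric.infDist_zero_of_mem (h s u)]
    norm_num
  · have hm := hJ.isIdemMultiplier (hN 0) (hs 0).isIdempotentElem
    have key s t := hJ.projClass_sub_projClass hm (hs s) (hs t) (hN s) (hN t) (h s 0) (h t 0)
    refine Subtype.ext ?_
    rw [FlowPartition.flow, key 0 1, AddSubgroup.val_finsetSum]
    simp only [key]
    rw [sum_castSucc_sub_succ (fun i => hm.relClass (h (P.t i) 0) (hs (P.t i)).isIdempotentElem)]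
    simp only [P.t_zero, P.t_last]

theorem HasSpectralFlow.unique {N : VonNeumannAlgebra H} {J : NonUnitalSubalgebra ℂ (H →L[ℂ] H)}
    {B : I → H →L[ℂ] H} {c c' : K0 J} (h : HasSpectralFlow N J B c)
    (h' : HasSpectralFlow N J B c') : c = c' := by
  obtain ⟨P⟩ := h.2.1
  rw [← (h.2.2 P).2, (h'.2.2 P).2]

/-! ### The index of a product of two projections. -/

theorem isSkewFredholm_mul {N : VonNeumannAlgebra H} {J : NonUnitalSubalgebra ℂ (H →L[ℂ] H)}
    (hJ : IsClosedIdeal N J) {p q : H →L[ℂ] H} (hp : IsStarProjection p) (hq : IsStarProjection q)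
    (hpN : p ∈ N) (hqN : q ∈ N) (hpq : p - q ∈ J) : IsSkewFredholm N J q p (q * p) := by
  refine ⟨⟨1, one_mem N, by rw [mul_one]⟩, p * q, ⟨1, one_mem N, by rw [mul_one]⟩, ?_, ?_⟩
  · have e : p * q * (q * p) - p = -(p * (p - q) * p) := by
      rw [mul_sub, sub_mul, hp.isIdempotentElem.eq, hp.isIdempotentElem.eq, neg_sub,
        mul_assoc p q (q * p), ← mul_assoc q q p, hq.isIdempotentElem.eq, ← mul_assoc]
    rw [e]
    exact J.neg_mem (hJ.mul_mem_right _ hpN _ (hJ.mul_mem_left _ hpN _ hpq))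
  · have e : q * p * (p * q) - q = q * (p - q) * q := by
      rw [mul_sub, sub_mul, hq.isIdempotentElem.eq, hq.isIdempotentElem.eq,
        mul_assoc q p (p * q), ← mul_assoc p p q, hp.isIdempotentElem.eq, ← mul_assoc]
    rw [e]
    exact hJ.mul_mem_right _ hqN _ (hJ.mul_mem_left _ hqN _ hpq)

/-- On the image of `p` the operators `q p` and `q` coincide, so their kernels meet it in the same
subspace. -/
theorem interProj_kerProj_mul {p q : H →L[ℂ] H} (hp : IsStarProjection p)
    (hq : IsStarProjection q) :
    interProj (kerProj (q * p)) p = interProj (1 - q) p := by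
  have : (kerProj (q * p)).range ⊓ p.range = (1 - q).range ⊓ p.range := by
    ext x
    have hk : x ∈ (kerProj (q * p)).range ↔ q (p x) = 0 := by
      rw [kerProj, Submodule.range_starProjection]
      rfl
    have hq' : x ∈ (1 - q).range ↔ q x = 0 := by
      constructor
      · rintro ⟨y, rfl⟩
        have := congrArg (fun A : H →L[ℂ] H => A y) hq.isIdempotentElem.eq
        change q (y - q y) = 0
        rw [map_sub, sub_eq_zero]
        exact this.symm
      · intro h
        exact ⟨x, by change x - q x = x; rw [h, sub_zero]⟩
    have hp' : x ∈ p.range → p x = x := by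
      rintro ⟨y, rfl⟩
      exact congrArg (fun A : H →L[ℂ] H => A y) hp.isIdempotentElem.eq
    rw [Submodule.mem_inf, Submodule.mem_inf, hk, hq']
    exact and_congr_left fun h => by rw [hp' h]
  simp only [interProj, this]

theorem skewIndex_mul (J : NonUnitalSubalgebra ℂ (H →L[ℂ] H)) {p q : H →L[ℂ] H}
    (hp : IsStarProjection p) (hq : IsStarProjection q) :
    skewIndex J q p (q * p) =
      projClass J (interProj (1 - q) p) - projClass J (interProj (1 - p) q) := by
  rw [skewIndex, star_mul, hp.isSelfAdjoint.star_eq, hq.isSelfAdjoint.star_eq,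
    interProj_kerProj_mul hp hq, interProj_kerProj_mul hq hp]

/-! ### Spectral flow of bounded perturbations -/

section Perturbation

variable {N : VonNeumannAlgebra H} {J : NonUnitalSubalgebra ℂ (H →L[ℂ] H)} {D : H →ₗ.[ℂ] H}

theorem IsClosedIdeal.resolventOp_perturb_mem (hJ : IsClosedIdeal N J) (hD : IsSelfAdjoint D)
    (hDN : IsAffiliated N D) {z : ℂ} (hz : z.im ≠ 0) (hDJ : resolventOp D z ∈ J)
    {A : H →L[ℂ] H} (hA : IsSelfAdjoint A) (hAN : A ∈ N) : resolventOp (perturb D A) z ∈ J := by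
  rw [resolventOp_perturb hD hA hz]
  exact J.add_mem hDJ (hJ.mul_mem_right _ (mul_mem hAN (resolventOp_mem
    (isSelfAdjoint_perturb hD hA) (isAffiliated_perturb hDN hAN) hz)) _ hDJ)

theorem IsClosedIdeal.one_sub_boundedTransform_sq_mem (hJ : IsClosedIdeal N J)
    (hD : IsSelfAdjoint D) (hDN : IsAffiliated N D) (hDJ : resolventOp D Complex.I ∈ J) :
    1 - boundedTransform D * boundedTransform D ∈ J := by
  rw [boundedTransform_mul_self hD, sub_sub_cancel, invSqrtOneAddSq_mul_self]
  exact hJ.mul_mem_left _ (star_mem (resolventOp_mem hD hDN I_im_ne_zero)) _ hDJ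

omit [CompleteSpace H] in
theorem perturb_perturb_sub (A B : H →L[ℂ] H) :
    perturb (perturb D A) (B - A) = perturb D B := by
  rw [perturb_perturb, sub_add_cancel]

theorem IsClosedIdeal.chi_perturb_sub_mem (hJ : IsClosedIdeal N J) (hD : IsSelfAdjoint D)
    (hDN : IsAffiliated N D) (hDJ : resolventOp D Complex.I ∈ J) {A B : H →L[ℂ] H}
    (hA : IsSelfAdjoint A) (hAN : A ∈ N) (hB : IsSelfAdjoint B) (hBN : B ∈ N) :
    chi (boundedTransform (perturb D B)) - chi (boundedTransform (perturb D A)) ∈ J := by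
  have hDA := isSelfAdjoint_perturb hD hA
  have hDB := isSelfAdjoint_perturb hD hB
  have hNA := isAffiliated_perturb hDN hAN
  have hNB := isAffiliated_perturb hDN hBN
  have hJA := hJ.resolventOp_perturb_mem hD hDN I_im_ne_zero hDJ hA hAN
  have hJB := hJ.resolventOp_perturb_mem hD hDN I_im_ne_zero hDJ hB hBN
  refine hJ.chi_sub_chi_mem (isSelfAdjoint_boundedTransform hDB) (boundedTransform_mem hDB hNB)
    (hJ.one_sub_boundedTransform_sq_mem hDB hNB hJB) (isSelfAdjoint_boundedTransform hDA)
    (boundedTransform_mem hDA hNA) (hJ.one_sub_boundedTransform_sq_mem hDA hNA hJA) ?_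
  have := hJ.boundedTransform_sub_mem hDA hNA hJA (A := B - A) (hB.sub hA) (sub_mem hBN hAN)
  rw [perturb_perturb_sub] at this
  exact this hJB

theorem IsClosedIdeal.isFredholmPath_perturb (hJ : IsClosedIdeal N J) (hD : IsSelfAdjoint D)
    (hDN : IsAffiliated N D) (hDJ : resolventOp D Complex.I ∈ J) {A : I → H →L[ℂ] H}
    (hAc : Continuous A) (hA : ∀ t, A t ∈ N ∧ IsSelfAdjoint (A t)) :
    IsFredholmPath N J fun t => boundedTransform (perturb D (A t)) := by
  refine ⟨?_, fun t => ?_⟩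
  · rw [continuous_iff_continuousAt]
    intro s
    rw [ContinuousAt, tendsto_iff_norm_sub_tendsto_zero]
    have h0 : Filter.Tendsto (fun t => 3 / 2 * ‖A t - A s‖) (nhds s) (nhds 0) := by
      have : Continuous fun t => 3 / 2 * ‖A t - A s‖ := by fun_prop
      simpa using this.tendsto s
    refine squeeze_zero (fun _ => norm_nonneg _) (fun t => ?_) h0
    have := norm_boundedTransform_sub_le (isSelfAdjoint_perturb hD (hA s).2)
      ((hA t).2.sub (hA s).2)
    rwa [perturb_perturb_sub] at this
  · have hDA := isSelfAdjoint_perturb hD (hA t).2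
    have hNA := isAffiliated_perturb hDN (hA t).1
    have hJA := hJ.resolventOp_perturb_mem hD hDN I_im_ne_zero hDJ (hA t).2 (hA t).1
    have h := boundedTransform_mem hDA hNA
    have h1 := J.neg_mem (hJ.one_sub_boundedTransform_sq_mem hDA hNA hJA)
    rw [neg_sub] at h1
    -- The bounded transform is its own parametrix, as its square is `1` modulo `J`.
    exact ⟨isSelfAdjoint_boundedTransform hDA, h, _, h, h1, h1⟩

theorem IsClosedIdeal.hasUnboundedSpectralFlow_perturb (hJ : IsClosedIdeal N J)
    (hD : IsSelfAdjoint D) (hDN : IsAffiliated N D) (hDJ : resolventOp D Complex.I ∈ J)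
    {A : I → H →L[ℂ] H} (hAc : Continuous A) (hA : ∀ t, A t ∈ N ∧ IsSelfAdjoint (A t)) :
    HasUnboundedSpectralFlow N J (fun t => perturb D (A t))
      (projClass J (interProj (1 - chi (boundedTransform (perturb D (A 1))))
          (chi (boundedTransform (perturb D (A 0))))) -
        projClass J (interProj (1 - chi (boundedTransform (perturb D (A 0))))
          (chi (boundedTransform (perturb D (A 1)))))) :=
  ⟨fun t => ⟨isSelfAdjoint_perturb hD (hA t).2, isAffiliated_perturb hDN (hA t).1⟩,
    hasSpectralFlow_of_chi_sub_mem hJ (hJ.isFredholmPath_perturb hD hDN hDJ hAc hA)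
      fun s t => hJ.chi_perturb_sub_mem hD hDN hDJ (hA t).2 (hA t).1 (hA s).2 (hA s).1⟩

end Perturbation

end VNSpectralFlow

end

open VNSpectralFlow in
theorem mainTheorem11 {H : Type*} [NormedAddCommGroup H] [InnerProductSpace ℂ H]
    [CompleteSpace H] {𝒜 : Type*} [NonUnitalRing 𝒜] [StarRing 𝒜] [Module ℂ 𝒜]
    [IsScalarTower ℂ 𝒜 𝒜] [SMulCommClass ℂ 𝒜 𝒜] [StarModule ℂ 𝒜]
    (N : VonNeumannAlgebra H) (J : NonUnitalSubalgebra ℂ (H →L[ℂ] H))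
    (ρ : 𝒜 →⋆ₙₐ[ℂ] (H →L[ℂ] H)) (D : H →ₗ.[ℂ] H)
    (hD : IsVNSpectralTriple N J ρ D) (hunital : ∃ a, ρ a = 1)
    (A : unitInterval → H →L[ℂ] H) (hAcont : Continuous A)
    (hA : ∀ t, A t ∈ N ∧ IsSelfAdjoint (A t))
    (p₀ p₁ : H →L[ℂ] H)
    (hp₀ : p₀ = chi (boundedTransform (perturb D (A 0))))
    (hp₁ : p₁ = chi (boundedTransform (perturb D (A 1)))) :
    (interProj (1 - p₁) p₀ ∈ J ∧ interProj (1 - p₀) p₁ ∈ J) ∧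
    HasUnboundedSpectralFlow N J (fun t => perturb D (A t))
      (projClass J (interProj (1 - p₁) p₀) - projClass J (interProj (1 - p₀) p₁)) ∧
    IsSkewFredholm N J p₁ p₀ (p₁ * p₀) ∧
    projClass J (interProj (1 - p₁) p₀) - projClass J (interProj (1 - p₀) p₁) =
      skewIndex J p₁ p₀ (p₁ * p₀) ∧
    ∀ A' : unitInterval → H →L[ℂ] H, Continuous A' →
      (∀ t, A' t ∈ N ∧ IsSelfAdjoint (A' t)) →
      perturb D (A' 0) = perturb D (A 0) → perturb D (A' 1) = perturb D (A 1) →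
      ∀ c : K0 J, HasUnboundedSpectralFlow N J (fun t => perturb D (A' t)) c ↔
        HasUnboundedSpectralFlow N J (fun t => perturb D (A t)) c := by
  have hJ := hD.isClosedIdeal
  -- Unitality enters here: with `ρ a = 1` the resolvent itself lies in `J`.
  have hDJ : resolventOp D Complex.I ∈ J := by
    obtain ⟨a, ha⟩ := hunital
    have h := hD.resolvent_mem Complex.I I_im_ne_zero a
    rwa [ha, one_mul] at h
  have hsa := hD.isSelfAdjoint
  have haff := hD.isAffiliated
  have flow := hJ.hasUnboundedSpectralFlow_perturb hsa haff hDJ hAcont hA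
  have hs₀ : IsStarProjection p₀ := hp₀ ▸ isStarProjection_chi _
  have hs₁ : IsStarProjection p₁ := hp₁ ▸ isStarProjection_chi _
  have hN₀ : p₀ ∈ N := hp₀ ▸ chi_mem (flow.2.1.2 0).2.1
  have hN₁ : p₁ ∈ N := hp₁ ▸ chi_mem (flow.2.1.2 1).2.1
  have h₀₁ : p₀ - p₁ ∈ J := by
    rw [hp₀, hp₁]
    exact hJ.chi_perturb_sub_mem hsa haff hDJ (hA 1).2 (hA 1).1 (hA 0).2 (hA 0).1
  have h₁₀ : p₁ - p₀ ∈ J := by rw [← neg_sub]; exact J.neg_mem h₀₁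
  rw [← hp₀, ← hp₁] at flow
  refine ⟨⟨hJ.interProj_mem hs₀ hs₁ hN₀ hN₁ h₀₁, hJ.interProj_mem hs₁ hs₀ hN₁ hN₀ h₁₀⟩, flow,
    isSkewFredholm_mul hJ hs₀ hs₁ hN₀ hN₁ h₀₁, (skewIndex_mul J hs₀ hs₁).symm, ?_⟩
  intro A' hA'cont hA' h0 h1 c
  -- The second path has the same end point expression as its spectral flow, and a path has at most
  -- one such value.
  have flow' := hJ.hasUnboundedSpectralFlow_perturb hsa haff hDJ hA'cont hA'
  rw [h0, h1, ← hp₀, ← hp₁] at flow'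
  constructor
  · intro h
    rw [h.2.unique flow'.2]
    exact flow
  · intro h
    rw [h.2.unique flow.2]
    exact flow'
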